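/- Let $L,\mu,\rho_1,\rho_2>0$ and let $\eta_\varepsilon$ be real numbers, $\varepsilon>0$, with $\eta_\varepsilon\to\infty$ as $\varepsilon\to0$. Let $S_1\subset\mathbb R^2$ be the unit circle with arc length $dv$, and let $\mathcal L$ be the linear Boltzmann operator $$\mathcal L f(v)=\mu\int_{-1}^1\big[f(v')-f(v)\big]\,d\rho,\qquad v'=v-2(n\cdot v)n,$$ where $n=n(v,\rho)\in S_1$ is the outward normal of a hard disk at the point where it is hit with velocity $v$ and impact parameter $\rho=\sin\alpha$, i.e. $-v$ rotated by the angle $\alpha\in[-\pi/2,\pi/2]$. Consider the stationary linear Boltzmann problem in the slab $$v_1\partial_x h=\eta_\varepsilon\,\mathcal L h\ \text{ in }(0,L)\times S_1,\qquad h(0,v)=\rho_1\ (v_1>0),\qquad h(L,v)=\rho_2\ (v_1<0). \tag{1}$$ A function $h\in L^\infty((0,L)\times S_1)$ is a solution if it has a representative which, for almost every $v$, is absolutely continuous in $x\in[0,L]$, satisfies the equation for almost every $x$ and takes the prescribed incoming boundary values. Then the following holds. (a) For $\varepsilon$ small enough, (1) has exactly one solution $h_\varepsilon^S\in L^\infty((0,L)\times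 S_1)$. (b) With $\varrho^S(x)=\dfrac{\rho_1(L-x)+\rho_2x}{L}$, one has $h_\varepsilon^S\to\varrho^S$ in $L^2((0,L)\times S_1)$ as $\varepsilon\to0$. (c) There is $h^{(1)}\in L^\infty(S_1)$ with $\int_{S_1}h^{(1)}dv=0$ and $\mathcal L h^{(1)}=\frac{\rho_2-\rho_1}{L}v_1$, and, if $R_\varepsilon$ is defined by $$h_\varepsilon^S=\varrho^S+\frac1{\eta_\varepsilon}h^{(1)}+\frac1{\eta_\varepsilon}R_\varepsilon ,\qquad \langle R_\varepsilon\rangle(x)=\frac1{2\pi}\int_{S_1}R_\varepsilon(x,v)\,dv,$$ then there is a constant $C$ such that, for all small $\varepsilon$, $$\|R_\varepsilon\|_{L^2((0,L)\times S_1)}\le C,\qquad \|R_\varepsilon-\langle R_\varepsilon\rangle\|_{L^2((0,L)\times S_1)}\le C\,\eta_\varepsilon^{-1/2}.$$ In particular the remainder term $\eta_\varepsilon^{-1}R_\varepsilon$ of the expansion is $O(\eta_\varepsilon^{-1})$ in $L^2$. -/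

import Mathlib

open MeasureTheory Set Filter Topology
open scoped ENNReal Real

noncomputable section

/-- `S₁`, realised as the unit circle of `ℂ = ℝ²`, carries its Borel sets. -/
instance circleMeasurableSpace : MeasurableSpace Circle := borel Circle

instance circleBorelSpace : BorelSpace Circle := ⟨rfl⟩

/-- Arc length `dv` on the unit circle `S₁ ⊂ ℂ = ℝ²` (total mass `2π`). -/
def arcLength : Measure Circle :=
  Measure.map Circle.exp (volume.restrict (Ioc (-π) π))

/-- The measure `dx dv` on the slab `(0, L) × S₁`. -/
def slabMeasure (L : ℝ) : Measure (ℝ × Circle) :=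
  (volume.restrict (Ioo 0 L)).prod arcLength

/-- Outward unit normal of a hard disk at the point where it is hit, with velocity `v` and impact
parameter `ρ = sin α ∈ [-1, 1]`: the rotation of `-v` by the angle `α`. -/
def outwardNormal (v : Circle) (ρ : ℝ) : Circle :=
  -(Circle.exp (Real.arcsin ρ) * v)

/-- The post-collisional velocity `v' = v - 2 (n · v) n`, as a point of the unit circle. -/
def scatter (v : Circle) (ρ : ℝ) : Circle :=
  ⟨(v : ℂ) - (2 * inner ℝ (outwardNormal v ρ : ℂ) (v : ℂ) : ℝ) • (outwardNormal v ρ : ℂ), by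
    have hn : ‖(outwardNormal v ρ : ℂ)‖ = 1 := Circle.norm_coe _
    have hv : ‖(v : ℂ)‖ = 1 := Circle.norm_coe _
    refine mem_sphere_zero_iff_norm.mpr ?_
    have h2 : ‖(v : ℂ) - (2 * inner ℝ (outwardNormal v ρ : ℂ) (v : ℂ) : ℝ) •
        (outwardNormal v ρ : ℂ)‖ ^ 2 = 1 := by
      rw [norm_sub_sq_real, norm_smul, inner_smul_right, real_inner_comm, mul_pow, hn, hv,
        Real.norm_eq_abs, sq_abs]
      ring
    exact (pow_eq_one_iff_of_nonneg (norm_nonneg _) two_ne_zero).mp h2⟩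

/-- The linear Boltzmann operator `𝓛 f (v) = μ ∫_{-1}^{1} (f(v') - f(v)) dρ`. -/
def linearBoltzmann (μ : ℝ) (f : Circle → ℝ) (v : Circle) : ℝ :=
  μ * ∫ ρ in (-1 : ℝ)..1, (f (scatter v ρ) - f v)

/-- `h ∈ L^∞((0, L) × S₁)` is a solution of the stationary linear Boltzmann problem
`v₁ ∂ₓ h = η 𝓛 h` in `(0, L) × S₁`, `h(0, v) = ρ₁` for `v₁ > 0`, `h(L, v) = ρ₂` for `v₁ < 0`.
As `h` is only a class of functions up to null sets, this is expressed through a representative `g`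
which, for almost every `v`, is absolutely continuous in `x` on `[0, L]`, satisfies the equation
for almost every `x`, and takes the incoming boundary values. -/
structure IsStationarySolution (L μ η ρ₁ ρ₂ : ℝ) (h : ℝ × Circle → ℝ) : Prop where
  memLp : MemLp h ∞ (slabMeasure L)
  exists_representative : ∃ g : ℝ × Circle → ℝ, g =ᵐ[slabMeasure L] h ∧
    ∀ᵐ v ∂arcLength,
      AbsolutelyContinuousOnInterval (fun x => g (x, v)) 0 L ∧
      (∀ᵐ x ∂volume.restrict (Ioo 0 L), ∃ d : ℝ, HasDerivAt (fun y => g (y, v)) d x ∧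
        (v : ℂ).re * d = η * linearBoltzmann μ (fun w => g (x, w)) v) ∧
      (0 < (v : ℂ).re → g (0, v) = ρ₁) ∧
      ((v : ℂ).re < 0 → g (L, v) = ρ₂)

/-- The linear profile `ϱ^S`. -/
def linearProfile (L ρ₁ ρ₂ x : ℝ) : ℝ :=
  (ρ₁ * (L - x) + ρ₂ * x) / L

/-- `h₁ = ((ρ₂ - ρ₁) / L) 𝓛⁻¹ v₁`: the bounded function of the velocity, of zero mean, with
`𝓛 h₁ = ((ρ₂ - ρ₁) / L) v₁`. -/
structure IsFirstCorrector (L μ ρ₁ ρ₂ : ℝ) (h₁ : Circle → ℝ) : Prop where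
  memLp : MemLp h₁ ∞ arcLength
  integral_eq_zero : ∫ v, h₁ v ∂arcLength = 0
  equation : ∀ᵐ v ∂arcLength, linearBoltzmann μ h₁ v = (ρ₂ - ρ₁) / L * (v : ℂ).re

/-- The remainder `R` in `h = ϱ^S + η⁻¹ h₁ + η⁻¹ R`. -/
def hilbertRemainder (L η ρ₁ ρ₂ : ℝ) (h₁ : Circle → ℝ) (h : ℝ × Circle → ℝ) :
    ℝ × Circle → ℝ :=
  fun z => η * (h z - linearProfile L ρ₁ ρ₂ z.1) - h₁ z.2

/-- The velocity average `⟨R⟩(x) = (2π)⁻¹ ∫_{S₁} R(x, v) dv`. -/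
def velocityAverage (R : ℝ × Circle → ℝ) (x : ℝ) : ℝ :=
  (2 * π)⁻¹ * ∫ v, R (x, v) ∂arcLength

end

/-! Write `𝓛 = μ (K - 2)`, where the gain `K f(v) = ∫ f(v') dρ` averages over rotations, since `v' =
-e^{2iα} v`. The coordinate `v₁` is an eigenfunction, `K v₁ = -(2/3) v₁`, so the first corrector is
an explicit multiple of `v₁`. As it does not depend on `x` and `ϱ^S` is linear, inserting the
expansion leaves no residual source: `R` solves the same equation `v₁ ∂ₓ R = η 𝓛 R`, with incoming
data `-h₁`.

The maximum principle then bounds `|R|` by `B = |3/(8μ) · (ρ₂ - ρ₁)/L|`, independently of `η`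
(`abs_transport_le`). This gives the bound on `R` in `L²` and, after division by `η`, the
convergence to `ϱ^S`. For the fluctuation, multiply by `R` and integrate: the boundary terms bound
the dissipation by `O(1/η)` (`integral_dissipation_le`), and the spectral gap of `K`
(`dissipation_ge`) turns this into a bound on `R - ⟨R⟩`.

Existence and uniqueness come from iterating on the source `φ = K u`: solve the transport problem
with source `φ` along each characteristic, then apply `K`. Mass alone makes this a non-strict
contraction in the sup norm. It is strict because, whatever the velocity before a collision, there
is a definite chance to scatter into a direction leaving the slab without further collision
(`abs_gain_le_of_escape`). Uniqueness runs the same contraction almost everywhere, because solutions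
are only classes of functions. -/

/-! ### Scattering as a rotation -/

/-- With `n = -e^{iα} v` one has `n · v = -cos α`, so `v' = (1 - 2 cos α e^{iα}) v`, and `2 cos α
e^{iα} = e^{2iα} + 1`. -/
theorem scatter_eq (v : Circle) (ρ : ℝ) :
    scatter v ρ = -(Circle.exp (2 * Real.arcsin ρ) * v) := by
  apply Circle.ext
  have hn : (outwardNormal v ρ : ℂ) = -(Circle.exp (Real.arcsin ρ) * v : ℂ) := by
    simp [outwardNormal]
  have hinner : inner ℝ (outwardNormal v ρ : ℂ) (v : ℂ) = -Real.cos (Real.arcsin ρ) := by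
    have hv : (v : ℂ).re * (v : ℂ).re + (v : ℂ).im * (v : ℂ).im = 1 := by
      have := Circle.normSq_coe v
      rwa [Complex.normSq_apply] at this
    rw [hn, Complex.inner, Circle.coe_exp]
    simp only [map_neg, map_mul, Complex.neg_re, Complex.mul_re, Complex.mul_im, Complex.conj_re,
      Complex.conj_im, Complex.neg_im, Complex.exp_ofReal_mul_I_re, Complex.exp_ofReal_mul_I_im]
    linear_combination (-Real.cos (Real.arcsin ρ)) * hv
  change (v : ℂ) - (2 * inner ℝ (outwardNormal v ρ : ℂ) (v : ℂ) : ℝ) • (outwardNormal v ρ : ℂ) = _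
  rw [hinner, hn]
  simp only [Circle.coe_neg, Circle.coe_mul, Circle.coe_exp, Complex.real_smul]
  push_cast
  set α : ℂ := (Real.arcsin ρ : ℂ)
  have h1 : Complex.exp (2 * α * Complex.I) = Complex.exp (α * Complex.I) ^ 2 := by
    rw [← Complex.exp_nat_mul]; congr 1; push_cast; ring
  have h2 : 2 * Complex.cos α = Complex.exp (α * Complex.I) + Complex.exp (-α * Complex.I) := by
    rw [Complex.cos]; ring
  have h3 : Complex.exp (α * Complex.I) * Complex.exp (-α * Complex.I) = 1 := by
    rw [← Complex.exp_add]; simp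
  rw [h1]
  linear_combination (-(Complex.exp (α * Complex.I) * (v : ℂ))) * h2 - (v : ℂ) * h3

theorem measurable_circleExp : Measurable Circle.exp :=
  Circle.exp.continuous.measurable

theorem exp_pi_mul (v : Circle) : Circle.exp π * v = -v := by
  apply Circle.ext
  simp [Circle.coe_exp, Complex.exp_pi_mul_I]

theorem scatter_eq_rotation (v : Circle) (ρ : ℝ) :
    scatter v ρ = Circle.exp (π + 2 * Real.arcsin ρ) * v := by
  rw [scatter_eq, Circle.exp_add, mul_assoc, exp_pi_mul]

theorem measurable_scatter : Measurable fun p : Circle × ℝ => scatter p.1 p.2 := by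
  have : Continuous fun p : Circle × ℝ => scatter p.1 p.2 := by
    simp_rw [scatter_eq_rotation]
    exact (Circle.exp.continuous.comp (continuous_const.add (continuous_const.mul
      (Real.continuous_arcsin.comp continuous_snd)))).mul continuous_fst
  exact this.measurable

/-! ### Arc length and its invariance -/

theorem lintegral_arcLength {f : Circle → ℝ≥0∞} (hf : Measurable f) :
    ∫⁻ v, f v ∂arcLength = ∫⁻ t in Ioc (-π) π, f (Circle.exp t) := by
  rw [arcLength, lintegral_map hf measurable_circleExp]

theorem integral_arcLength {f : Circle → ℝ} (hf : Measurable f) :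
    ∫ v, f v ∂arcLength = ∫ t in (-π)..π, f (Circle.exp t) := by
  rw [arcLength, integral_map measurable_circleExp.aemeasurable hf.aestronglyMeasurable,
    intervalIntegral.integral_of_le (by linarith [Real.pi_pos])]

theorem arcLength_univ : arcLength univ = ENNReal.ofReal (2 * π) := by
  rw [arcLength, Measure.map_apply measurable_circleExp MeasurableSet.univ]
  simp only [preimage_univ, Measure.restrict_apply MeasurableSet.univ, univ_inter, Real.volume_Ioc]
  congr 1; ring

instance : IsFiniteMeasure arcLength := ⟨by rw [arcLength_univ]; exact ENNReal.ofReal_lt_top⟩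

theorem measureReal_arcLength_univ : arcLength.real univ = 2 * π := by
  rw [Measure.real, arcLength_univ, ENNReal.toReal_ofReal (by positivity)]

/-- A rotation shifts the arc of parameters, and any two half-open intervals of length `2π` are
fundamental domains for the period, so they give the same integral. -/
theorem measurePreserving_rotation (s : ℝ) :
    MeasurePreserving (fun v : Circle => Circle.exp s * v) arcLength arcLength := by
  have hm : Measurable fun v : Circle => Circle.exp s * v := (continuous_const_mul _).measurable
  refine ⟨hm, Measure.ext_of_lintegral _ fun f hf => ?_⟩
  rw [lintegral_map hf hm, lintegral_arcLength (f := fun v => f (Circle.exp s * v))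
    (hf.comp hm), lintegral_arcLength hf]
  simp_rw [← Circle.exp_add]
  have h1 : ∫⁻ t in Ioc (-π) π, f (Circle.exp (s + t))
      = ∫⁻ t in Ioc (s + -π) (s + -π + 2 * π), f (Circle.exp t) := by
    have := (measurePreserving_add_left (volume : Measure ℝ) s).setLIntegral_comp_emb
      (measurableEmbedding_addLeft s) (fun t => f (Circle.exp t)) (Ioc (-π) π)
    rw [image_const_add_Ioc] at this
    rw [show s + -π + 2 * π = s + π by ring]
    exact this
  have h2 : ∫⁻ t in Ioc (-π) π, f (Circle.exp t)
      = ∫⁻ t in Ioc (-π) (-π + 2 * π), f (Circle.exp t) := by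
    congr 2; ring_nf
  rw [h1, h2]
  have : VAddInvariantMeasure (AddSubgroup.zmultiples (2 * π)) ℝ volume :=
    ⟨fun c s _ => measure_preimage_add _ _ _⟩
  refine IsAddFundamentalDomain.setLIntegral_eq (G := AddSubgroup.zmultiples (2 * π))
    (isAddFundamentalDomain_Ioc Real.two_pi_pos _) (isAddFundamentalDomain_Ioc Real.two_pi_pos _)
    _ ?_
  exact (Circle.periodic_exp.comp f).map_vadd_zmultiples

theorem measurePreserving_scatter (ρ : ℝ) :
    MeasurePreserving (fun v : Circle => scatter v ρ) arcLength arcLength := by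
  simp_rw [scatter_eq_rotation]
  exact measurePreserving_rotation _

theorem measurable_circle_re : Measurable fun v : Circle => (v : ℂ).re := by
  have : Continuous fun v : Circle => (v : ℂ).re := by fun_prop
  exact this.measurable

theorem ae_re_ne_zero : ∀ᵐ v : Circle ∂arcLength, (v : ℂ).re ≠ 0 := by
  have hm : MeasurableSet {v : Circle | (v : ℂ).re ≠ 0} :=
    (measurable_circle_re (measurableSet_singleton (0 : ℝ))).compl
  rw [arcLength, ae_map_iff measurable_circleExp.aemeasurable hm]
  refine ae_restrict_of_ae ?_
  have hc : {t : ℝ | Real.cos t = 0}.Countable := by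
    have : {t : ℝ | Real.cos t = 0} = range fun k : ℤ => (2 * (k : ℝ) + 1) * π / 2 := by
      ext t
      simp only [mem_ofPred_eq, Real.cos_eq_zero_iff, mem_range, eq_comm (a := t)]
    rw [this]
    exact countable_range _
  filter_upwards [hc.ae_notMem volume] with t ht
  simpa [Circle.coe_exp, Complex.exp_ofReal_mul_I_re] using ht

/-! ### The relaxation equation along a characteristic -/

/-- The solution of `u' = a (φ - 2 u)`, `u e = b`, given by the variation of constants formula. -/
noncomputable def relaxation (a e b : ℝ) (φ : ℝ → ℝ) (x : ℝ) : ℝ :=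
  Real.exp (-(2 * a * (x - e))) * (b + a * ∫ y in e..x, Real.exp (2 * a * (y - e)) * φ y)

theorem relaxation_self (a e b : ℝ) (φ : ℝ → ℝ) : relaxation a e b φ e = b := by
  simp [relaxation]

/-- In the variation of constants formula the source carries a weight of total mass `(1 - exp(-2a(x
- e))) / 2`. The hypothesis on `a * (x - e)` says that `x` is downstream of `e`, so the exponential
is at most `1`. -/
theorem abs_relaxation_sub_le {a e b x N : ℝ} {φ : ℝ → ℝ} (hax : 0 ≤ a * (x - e))
    (hφ : ∀ᵐ y, y ∈ uIoc e x → |φ y| ≤ N) (hN : 0 ≤ N) :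
    |relaxation a e b φ x - Real.exp (-(2 * a * (x - e))) * b|
      ≤ N / 2 * (1 - Real.exp (-(2 * a * (x - e)))) := by
  have hg : Continuous fun y : ℝ => Real.exp (2 * a * (y - e)) * N := by fun_prop
  have h1 : |∫ y in e..x, Real.exp (2 * a * (y - e)) * φ y|
      ≤ |∫ y in e..x, Real.exp (2 * a * (y - e)) * N| := by
    have hgi : IntervalIntegrable _ volume e x := hg.intervalIntegrable _ _
    have hle : ∀ᵐ y ∂volume.restrict (uIoc e x),
        ‖Real.exp (2 * a * (y - e)) * φ y‖ ≤ Real.exp (2 * a * (y - e)) * N := by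
      filter_upwards [(ae_restrict_iff' measurableSet_uIoc).2 hφ] with y hy
      rw [Real.norm_eq_abs, abs_mul, Real.abs_exp]
      gcongr
    exact intervalIntegral.norm_integral_le_abs_of_norm_le hle hgi
  have h2 : a * ∫ y in e..x, Real.exp (2 * a * (y - e)) * N
      = N / 2 * (Real.exp (2 * a * (x - e)) - 1) := by
    rw [← intervalIntegral.integral_const_mul]
    rw [intervalIntegral.integral_eq_sub_of_hasDerivAt
      (f := fun y => N / 2 * Real.exp (2 * a * (y - e)))]
    · simp; ring
    · intro y _
      have : HasDerivAt (fun y => 2 * a * (y - e)) (2 * a) y := by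
        simpa using ((hasDerivAt_id y).sub_const e).const_mul (2 * a)
      convert! this.exp.const_mul (N / 2) using 1
      ring
    · exact (hg.const_mul a).intervalIntegrable _ _
  have h3 : relaxation a e b φ x - Real.exp (-(2 * a * (x - e))) * b
      = Real.exp (-(2 * a * (x - e))) * (a * ∫ y in e..x, Real.exp (2 * a * (y - e)) * φ y) := by
    rw [relaxation]; ring
  have h4 : 0 ≤ N / 2 * (Real.exp (2 * a * (x - e)) - 1) := by
    have := Real.one_le_exp (show 0 ≤ 2 * a * (x - e) by linarith)
    have : 0 ≤ Real.exp (2 * a * (x - e)) - 1 := by linarith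
    positivity
  rw [h3, abs_mul, Real.abs_exp, abs_mul]
  calc _ ≤ Real.exp (-(2 * a * (x - e))) *
        (|a| * |∫ y in e..x, Real.exp (2 * a * (y - e)) * N|) := by gcongr
    _ = _ := by
      rw [← abs_mul, h2, abs_of_nonneg h4, Real.exp_neg]
      have := (Real.exp_pos (2 * a * (x - e))).ne'
      field_simp

section Relaxation

variable {a e b L : ℝ} {φ u : ℝ → ℝ}

theorem hasDerivAt_exp_mul_sub (a e x : ℝ) :
    HasDerivAt (fun y => Real.exp (a * (y - e))) (a * Real.exp (a * (x - e))) x := by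
  have : HasDerivAt (fun y => a * (y - e)) a x := by
    simpa using ((hasDerivAt_id x).sub_const e).const_mul a
  simpa [mul_comm] using this.exp

theorem absolutelyContinuousOnInterval_exp (a e x y : ℝ) :
    AbsolutelyContinuousOnInterval (fun z => Real.exp (a * (z - e))) x y := by
  apply ContDiffOn.absolutelyContinuousOnInterval
  apply ContDiff.contDiffOn
  fun_prop

theorem intervalIntegrable_exp_mul (hφ : IntervalIntegrable φ volume 0 L) :
    IntervalIntegrable (fun y => Real.exp (2 * a * (y - e)) * φ y) volume 0 L :=
  hφ.continuousOn_mul (by fun_prop)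

theorem absolutelyContinuousOnInterval_relaxation (hφ : IntervalIntegrable φ volume 0 L)
    (he : e ∈ uIcc 0 L) : AbsolutelyContinuousOnInterval (relaxation a e b φ) 0 L := by
  have h := ((intervalIntegrable_exp_mul (a := a) (e := e) hφ
    ).absolutelyContinuousOnInterval_intervalIntegral he).const_mul a
  have hb : AbsolutelyContinuousOnInterval (fun _ : ℝ => b) 0 L :=
    contDiff_const.contDiffOn.absolutelyContinuousOnInterval
  have := (absolutelyContinuousOnInterval_exp (-(2 * a)) e 0 L).mul (hb.add h)
  convert! this using 1
  ext x
  simp [relaxation]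

theorem hasDerivAt_relaxation (hφ : IntervalIntegrable φ volume 0 L) (he : e ∈ uIcc 0 L) :
    ∀ᵐ x, x ∈ uIcc 0 L →
      HasDerivAt (relaxation a e b φ) (a * (φ x - 2 * relaxation a e b φ x)) x := by
  filter_upwards [(intervalIntegrable_exp_mul (a := a) (e := e) hφ).ae_hasDerivAt_integral]
    with x hx hxL
  have h1 := ((hx hxL e he).const_mul a).const_add b
  have h2 := (hasDerivAt_exp_mul_sub (-(2 * a)) e x).mul h1
  simp only [neg_mul] at h2
  convert! h2 using 1
  rw [relaxation, Real.exp_neg]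
  have := (Real.exp_pos (2 * a * (x - e))).ne'
  field_simp
  ring

theorem eq_relaxation (hu : AbsolutelyContinuousOnInterval u 0 L)
    (hφ : IntervalIntegrable φ volume 0 L) (he : e ∈ uIcc 0 L)
    (hd : ∀ᵐ x, x ∈ uIcc 0 L → HasDerivAt u (a * (φ x - 2 * u x)) x) {x : ℝ}
    (hx : x ∈ uIcc 0 L) : u x = relaxation a e (u e) φ x := by
  -- The difference of the two solutions times the integrating factor has zero derivative almost
  -- everywhere. Absolute continuity makes it constant, and it vanishes at `e`.
  have hac := (absolutelyContinuousOnInterval_exp (2 * a) e 0 L).fun_mul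
    (hu.fun_sub (absolutelyContinuousOnInterval_relaxation (a := a) (b := u e) hφ he))
  obtain ⟨C, hC⟩ := hac.const_of_ae_hasDerivAt_zero (by
    filter_upwards [hd, hasDerivAt_relaxation (a := a) (b := u e) hφ he] with y h1 h2 hy
    convert! (hasDerivAt_exp_mul_sub (2 * a) e y).mul ((h1 hy).sub (h2 hy)) using 1
    simp only [Pi.sub_apply]
    ring)
  have hCe := hC e he
  simp only [relaxation_self, sub_self, mul_zero] at hCe
  have hCx := hC x hx
  rw [← hCe, mul_eq_zero] at hCx
  rcases hCx with h | h
  · exact absurd h (Real.exp_pos _).ne'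
  · linarith

/-- Energy identity: this is the integral of `(u²)' = 2 u u'`. -/
theorem sq_sub_sq_eq_integral (hu : AbsolutelyContinuousOnInterval u 0 L)
    (hd : ∀ᵐ x, x ∈ uIcc 0 L → HasDerivAt u (a * (φ x - 2 * u x)) x) :
    u L ^ 2 - u 0 ^ 2 = -(2 * a) * ∫ x in (0 : ℝ)..L, u x * (2 * u x - φ x) := by
  have h := hu.integral_deriv_mul_eq_sub hu
  rw [sq, sq, ← h, ← intervalIntegral.integral_const_mul]
  apply intervalIntegral.integral_congr_ae
  filter_upwards [hd] with x hx hxL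
  rw [(hx (uIoc_subset_uIcc hxL)).deriv]
  ring

theorem ae_mem_uIcc_of_ae_restrict_Ioo (hL : 0 ≤ L) {p : ℝ → Prop}
    (h : ∀ᵐ x ∂volume.restrict (Ioo 0 L), p x) : ∀ᵐ x, x ∈ uIcc 0 L → p x := by
  rw [uIcc_of_le hL, ← ae_restrict_iff' measurableSet_Icc, ← restrict_Ioo_eq_restrict_Icc]
  exact h

theorem ae_restrict_Ioo_of_ae_mem_uIcc (hL : 0 ≤ L) {p : ℝ → Prop}
    (h : ∀ᵐ x, x ∈ uIcc 0 L → p x) : ∀ᵐ x ∂volume.restrict (Ioo 0 L), p x := by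
  rw [restrict_Ioo_eq_restrict_Icc, ae_restrict_iff' measurableSet_Icc, ← uIcc_of_le hL]
  exact h

end Relaxation

/-! ### The gain operator -/

/-- The gain part `f ↦ ∫_{-1}^{1} f(v') dρ` of the linear Boltzmann operator. -/
noncomputable def gain (f : Circle → ℝ) (v : Circle) : ℝ :=
  ∫ ρ in (-1 : ℝ)..1, f (scatter v ρ)

/-- Variable endpoints are needed because integration along a characteristic starts at a
velocity-dependent end of the slab and stops at `x`. -/
theorem measurable_intervalIntegral {α : Type*} [MeasurableSpace α] {F : α × ℝ → ℝ}
    (hF : Measurable F) {c d : α → ℝ} (hc : Measurable c) (hd : Measurable d) :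
    Measurable fun p => ∫ y in c p..d p, F (p, y) := by
  have key : ∀ {c d : α → ℝ}, Measurable c → Measurable d →
      Measurable fun p => ∫ y in Ioc (c p) (d p), F (p, y) := by
    intro c d hc hd
    have hs : MeasurableSet {q : α × ℝ | c q.1 < q.2 ∧ q.2 ≤ d q.1} :=
      (measurableSet_lt (hc.comp measurable_fst) measurable_snd).inter
        (measurableSet_le measurable_snd (hd.comp measurable_fst))
    have := ((hF.indicator hs).stronglyMeasurable.integral_prod_right' (ν := volume)).measurable
    convert! this using 2 with p
    rw [← integral_indicator measurableSet_Ioc]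
    rfl
  simp_rw [intervalIntegral]
  exact (key hc hd).sub (key hd hc)

theorem measurable_gain {α : Type*} [MeasurableSpace α] {f : α × Circle → ℝ}
    (hf : Measurable f) : Measurable fun z : α × Circle => gain (fun w => f (z.1, w)) z.2 := by
  have h : Measurable fun q : (α × Circle) × ℝ => f (q.1.1, scatter q.1.2 q.2) :=
    hf.comp (measurable_fst.fst.prodMk
      (measurable_scatter.comp (measurable_fst.snd.prodMk measurable_snd)))
  exact measurable_intervalIntegral h measurable_const measurable_const

theorem measurable_scatter_right (v : Circle) : Measurable (scatter v) :=
  measurable_scatter.comp measurable_prodMk_left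

theorem intervalIntegrable_comp_scatter {f : Circle → ℝ} {C : ℝ} (hf : Measurable f)
    (hC : ∀ v, |f v| ≤ C) (v : Circle) :
    IntervalIntegrable (fun ρ => f (scatter v ρ)) volume (-1) 1 := by
  rw [intervalIntegrable_iff]
  exact Measure.integrableOn_of_bounded (M := C) (by simp)
    (hf.comp (measurable_scatter_right v)).aestronglyMeasurable
    (ae_of_all _ fun ρ => hC _)

theorem abs_gain_le {f : Circle → ℝ} {v : Circle} {C : ℝ}
    (hC : ∀ᵐ ρ ∂volume.restrict (Ioc (-1 : ℝ) 1), |f (scatter v ρ)| ≤ C) :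
    |gain f v| ≤ 2 * C := by
  rw [ae_restrict_iff' measurableSet_Ioc] at hC
  have := intervalIntegral.norm_integral_le_of_norm_le_const_ae (a := (-1 : ℝ)) (b := 1)
    (f := fun ρ => f (scatter v ρ)) (C := C) (by rwa [uIoc_of_le (by norm_num)])
  rw [Real.norm_eq_abs] at this
  calc _ ≤ C * |(1 : ℝ) - -1| := this
    _ = 2 * C := by norm_num; ring

theorem linearBoltzmann_eq_gain {μ : ℝ} {f : Circle → ℝ} {v : Circle}
    (hf : IntervalIntegrable (fun ρ => f (scatter v ρ)) volume (-1) 1) :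
    linearBoltzmann μ f v = μ * (gain f v - 2 * f v) := by
  rw [linearBoltzmann, gain, intervalIntegral.integral_sub hf (by simp)]
  congr 2
  simp
  norm_num

theorem re_scatter (v : Circle) {ρ : ℝ} (hρ : ρ ∈ Icc (-1 : ℝ) 1) :
    (scatter v ρ : ℂ).re
      = -((v : ℂ).re * (1 - 2 * ρ ^ 2)) + (v : ℂ).im * (2 * ρ * √(1 - ρ ^ 2)) := by
  have h1 : Real.cos (2 * Real.arcsin ρ) = 1 - 2 * ρ ^ 2 := by
    rw [Real.cos_two_mul, Real.cos_arcsin, Real.sq_sqrt (by nlinarith [hρ.1, hρ.2])]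
    ring
  have h2 : Real.sin (2 * Real.arcsin ρ) = 2 * ρ * √(1 - ρ ^ 2) := by
    rw [Real.sin_two_mul, Real.cos_arcsin, Real.sin_arcsin hρ.1 hρ.2]
  rw [scatter_eq]
  simp only [Circle.coe_neg, Circle.coe_mul, Circle.coe_exp, Complex.neg_re, Complex.mul_re,
    Complex.exp_ofReal_mul_I_re, Complex.exp_ofReal_mul_I_im]
  rw [h1, h2]
  ring

theorem integral_odd_eq_zero {f : ℝ → ℝ} (hf : ∀ x, f (-x) = -f x) (a : ℝ) :
    ∫ x in (-a)..a, f x = 0 := by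
  have h := intervalIntegral.integral_comp_neg (a := -a) (b := a) f
  simp_rw [hf, intervalIntegral.integral_neg, neg_neg] at h
  linarith

/-- The term with the square root is odd in `ρ`; the rest is `-v₁ ∫ (1 - 2ρ²) dρ`. This eigenvalue
makes the first corrector explicit. -/
theorem gain_re (v : Circle) : gain (fun w => (w : ℂ).re) v = -(2 / 3) * (v : ℂ).re := by
  have h : gain (fun w => (w : ℂ).re) v = ∫ ρ in (-1 : ℝ)..1,
      (-((v : ℂ).re * (1 - 2 * ρ ^ 2)) + (v : ℂ).im * (2 * ρ * √(1 - ρ ^ 2))) :=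
    intervalIntegral.integral_congr fun ρ hρ => re_scatter v (by
      rwa [uIcc_of_le (by norm_num)] at hρ)
  have c1 : Continuous fun ρ : ℝ => -((v : ℂ).re * (1 - 2 * ρ ^ 2)) := by fun_prop
  have c2 : Continuous fun ρ : ℝ => (v : ℂ).im * (2 * ρ * √(1 - ρ ^ 2)) := by fun_prop
  rw [h, intervalIntegral.integral_add (c1.intervalIntegrable _ _) (c2.intervalIntegrable _ _),
    integral_odd_eq_zero (f := fun ρ : ℝ => (v : ℂ).im * (2 * ρ * √(1 - ρ ^ 2)))
      (fun x => by rw [neg_sq]; ring) 1, intervalIntegral.integral_neg,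
    intervalIntegral.integral_const_mul, intervalIntegral.integral_sub (by simp)
      (Continuous.intervalIntegrable (by fun_prop) _ _), intervalIntegral.integral_const_mul]
  simp
  ring

/-- Dropping the part odd in `ρ`, the integral equals `(14/15) v₁² + (16/15) v₂²`. Hence scattering
from any direction reaches velocities that are not nearly parallel to the boundary. -/
theorem gain_re_sq_ge (v : Circle) : 14 / 15 ≤ gain (fun w => (w : ℂ).re ^ 2) v := by
  have h : gain (fun w => (w : ℂ).re ^ 2) v = ∫ ρ in (-1 : ℝ)..1,
      (((v : ℂ).re ^ 2 * (1 - 2 * ρ ^ 2) ^ 2 + (v : ℂ).im ^ 2 * (4 * ρ ^ 2 * (1 - ρ ^ 2))) +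
        -((v : ℂ).re * (v : ℂ).im * 4 * (1 - 2 * ρ ^ 2)) * (ρ * √(1 - ρ ^ 2))) := by
    refine intervalIntegral.integral_congr fun ρ hρ => ?_
    rw [uIcc_of_le (by norm_num)] at hρ
    simp only [re_scatter v hρ]
    linear_combination ((v : ℂ).im ^ 2 * 4 * ρ ^ 2) *
      Real.sq_sqrt (show 0 ≤ 1 - ρ ^ 2 by nlinarith [hρ.1, hρ.2])
  have hpoly : ∀ ρ : ℝ, (v : ℂ).re ^ 2 * (1 - 2 * ρ ^ 2) ^ 2 +
      (v : ℂ).im ^ 2 * (4 * ρ ^ 2 * (1 - ρ ^ 2)) = (v : ℂ).re ^ 2 +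
        (4 * ((v : ℂ).im ^ 2 - (v : ℂ).re ^ 2)) * ρ ^ 2 +
        (4 * ((v : ℂ).re ^ 2 - (v : ℂ).im ^ 2)) * ρ ^ 4 := fun ρ => by ring
  have hv : (v : ℂ).re ^ 2 + (v : ℂ).im ^ 2 = 1 := by
    have := Circle.normSq_coe v
    rw [Complex.normSq_apply] at this
    linarith
  rw [h, intervalIntegral.integral_add (Continuous.intervalIntegrable (by fun_prop) _ _)
      (Continuous.intervalIntegrable (by fun_prop) _ _),
    integral_odd_eq_zero (f := fun ρ : ℝ =>
      -((v : ℂ).re * (v : ℂ).im * 4 * (1 - 2 * ρ ^ 2)) * (ρ * √(1 - ρ ^ 2)))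
      (fun x => by rw [neg_sq]; ring) 1]
  simp_rw [hpoly]
  rw [intervalIntegral.integral_add (Continuous.intervalIntegrable (by fun_prop) _ _)
      (Continuous.intervalIntegrable (by fun_prop) _ _),
    intervalIntegral.integral_add (Continuous.intervalIntegrable (by fun_prop) _ _)
      (Continuous.intervalIntegrable (by fun_prop) _ _)]
  simp only [intervalIntegral.integral_const_mul, integral_pow, intervalIntegral.integral_const]
  norm_num
  nlinarith [sq_nonneg (v : ℂ).re, sq_nonneg (v : ℂ).im]

/-! ### Escape from the slab and the contraction factor -/

theorem abs_re_le_one (v : Circle) : |(v : ℂ).re| ≤ 1 :=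
  (Complex.abs_re_le_norm (v : ℂ)).trans_eq (Circle.norm_coe v)

/-- A polynomial minorant of the escape probability, integrable in closed form. It is non-positive
for `|w₁| ≤ 1/2`; for `|w₁| > 1/2` the exponent `2l/|w₁|` is at most `4l` and the polynomial factor
at most `1`. -/
theorem exp_neg_div_ge {l : ℝ} (hl : 0 ≤ l) (w : Circle) :
    Real.exp (-(4 * l)) * ((w : ℂ).re ^ 2 - 1 / 4)
      ≤ Real.exp (-(2 * l / |(w : ℂ).re|)) := by
  have hw := abs_re_le_one w
  have hsq : (w : ℂ).re ^ 2 = |(w : ℂ).re| ^ 2 := (sq_abs _).symm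
  rw [hsq]
  set t := |(w : ℂ).re|
  have ht : 0 ≤ t := abs_nonneg _
  rcases le_or_gt t (1 / 2) with h | h
  · have h1 : t ^ 2 - 1 / 4 ≤ 0 := by nlinarith
    exact (mul_nonpos_of_nonneg_of_nonpos (Real.exp_pos _).le h1).trans (Real.exp_pos _).le
  · have h1 : 2 * l / t ≤ 4 * l := by
      rw [div_le_iff₀ (by linarith)]
      nlinarith
    calc _ ≤ Real.exp (-(4 * l)) * 1 := by gcongr; nlinarith
      _ ≤ _ := by rw [mul_one]; gcongr

/-- With `δ = exp(-4l)`, integrating the minorant gives at most `N (1 + δ/4) - (7/15) N δ = N (1 -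
(13/60) δ)`, and `13/60 ≥ 1/5`. The resulting factor is below `1` uniformly in `v`, although the
hypothesis alone allows `N/2` for nearly vertical velocities. -/
theorem abs_gain_le_of_escape {l N : ℝ} (hl : 0 ≤ l) (hN : 0 ≤ N) {f : Circle → ℝ} {v : Circle}
    (hf : ∀ᵐ ρ ∂volume.restrict (Ioc (-1 : ℝ) 1), |f (scatter v ρ)|
      ≤ N / 2 * (1 - Real.exp (-(2 * l / |(scatter v ρ : ℂ).re|)))) :
    |gain f v| ≤ (1 - Real.exp (-(4 * l)) / 5) * N := by
  set δ := Real.exp (-(4 * l))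
  have hδ : 0 < δ := Real.exp_pos _
  have hsq : IntervalIntegrable (fun ρ => (scatter v ρ : ℂ).re ^ 2) volume (-1) 1 :=
    intervalIntegrable_comp_scatter (f := fun w => (w : ℂ).re ^ 2) (C := 1)
      (measurable_circle_re.pow_const 2) (fun w => by
        rw [abs_of_nonneg (sq_nonneg _), sq_le_one_iff_abs_le_one]; exact abs_re_le_one w) v
  have hg : IntervalIntegrable (fun ρ => N / 2 * (1 + δ / 4) - N / 2 * δ *
      (scatter v ρ : ℂ).re ^ 2) volume (-1) 1 :=
    intervalIntegrable_const.sub (hsq.const_mul _)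
  have h1 : |gain f v| ≤ ∫ ρ in (-1 : ℝ)..1, (N / 2 * (1 + δ / 4) - N / 2 * δ *
      (scatter v ρ : ℂ).re ^ 2) := by
    have hle : ∀ᵐ ρ : ℝ, ρ ∈ Ioc (-1 : ℝ) 1 → ‖f (scatter v ρ)‖ ≤
        N / 2 * (1 + δ / 4) - N / 2 * δ * (scatter v ρ : ℂ).re ^ 2 := by
      filter_upwards [(ae_restrict_iff' measurableSet_Ioc).1 hf] with ρ h hρ
      have h2 := mul_le_mul_of_nonneg_left (exp_neg_div_ge hl (scatter v ρ))
        (show 0 ≤ N / 2 by positivity)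
      have h3 := h hρ
      rw [Real.norm_eq_abs]
      linarith
    exact intervalIntegral.norm_integral_le_of_norm_le (by norm_num) hle hg
  rw [intervalIntegral.integral_sub intervalIntegrable_const (hsq.const_mul _)] at h1
  simp only [intervalIntegral.integral_const_mul, intervalIntegral.integral_const,
    smul_eq_mul] at h1
  have h2 := mul_le_mul_of_nonneg_left (gain_re_sq_ge v) (show 0 ≤ N / 2 * δ by positivity)
  rw [gain] at h2
  have h4 : 0 ≤ N * δ := by positivity
  linarith

/-! ### Transport in the slab and the source iteration -/

section Slab

variable {L κ : ℝ}

/-- The end of the slab `[0, L]` through which particles of velocity `v` enter. -/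
noncomputable def entryPoint (L : ℝ) (v : Circle) : ℝ := if 0 < (v : ℂ).re then 0 else L

/-- The solution of `v₁ ∂ₓ u = κ (φ - 2 u)` in the slab with incoming data `b`. -/
noncomputable def transport (L κ : ℝ) (b : Circle → ℝ) (φ : ℝ × Circle → ℝ) (z : ℝ × Circle) : ℝ :=
  relaxation (κ / (z.2 : ℂ).re) (entryPoint L z.2) (b z.2) (fun y => φ (y, z.2)) z.1

theorem entryPoint_mem (L : ℝ) (v : Circle) : entryPoint L v ∈ uIcc 0 L := by
  rw [entryPoint]
  split_ifs <;> simp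

theorem measurable_entryPoint (L : ℝ) : Measurable (entryPoint L) :=
  Measurable.ite (measurableSet_lt measurable_const measurable_circle_re) measurable_const
    measurable_const

theorem measurable_transport {b : Circle → ℝ} {φ : ℝ × Circle → ℝ} (hb : Measurable b)
    (hφ : Measurable φ) : Measurable (transport L κ b φ) := by
  have ha : Measurable fun z : ℝ × Circle => κ / (z.2 : ℂ).re :=
    measurable_const.div (measurable_circle_re.comp measurable_snd)
  have he : Measurable fun z : ℝ × Circle => entryPoint L z.2 :=
    (measurable_entryPoint L).comp measurable_snd
  have hF : Measurable fun q : (ℝ × Circle) × ℝ =>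
      Real.exp (2 * (κ / (q.1.2 : ℂ).re) * (q.2 - entryPoint L q.1.2)) * φ (q.2, q.1.2) :=
    (((ha.comp measurable_fst).const_mul 2).mul
      (measurable_snd.sub (he.comp measurable_fst))).exp.mul
      (hφ.comp (measurable_snd.prodMk measurable_fst.snd))
  have hI := measurable_intervalIntegral hF he measurable_fst
  exact (((ha.const_mul 2).mul (measurable_fst.sub he)).neg.exp).mul
    ((hb.comp measurable_snd).add (ha.mul hI))

/-- Every point of the slab lies downstream of the entry point. When `v₁ = 0` the convention `κ / 0
= 0` freezes the characteristic, so this and the bounds after it hold for every `v`. -/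
theorem flight_nonneg (hκ : 0 ≤ κ) {x : ℝ} (hx : x ∈ Icc 0 L) (v : Circle) :
    0 ≤ κ / (v : ℂ).re * (x - entryPoint L v) := by
  rw [entryPoint]
  split_ifs with h
  · have := hx.1
    positivity
  · exact mul_nonneg_of_nonpos_of_nonpos (div_nonpos_of_nonneg_of_nonpos hκ (not_lt.1 h))
      (by linarith [hx.2])

theorem flight_le (hκ : 0 ≤ κ) {x : ℝ} (hx : x ∈ Icc 0 L) (v : Circle) :
    κ / (v : ℂ).re * (x - entryPoint L v) ≤ κ * L / |(v : ℂ).re| := by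
  rw [entryPoint]
  split_ifs with h
  · rw [abs_of_pos h, sub_zero, div_mul_eq_mul_div]
    gcongr
    exact hx.2
  · rw [abs_of_nonpos (not_lt.1 h), div_mul_eq_mul_div, ← neg_div_neg_eq]
    have : 0 ≤ -(v : ℂ).re := by linarith [not_lt.1 h]
    gcongr
    nlinarith [hx.1]

theorem one_sub_exp_flight_le (hκ : 0 ≤ κ) {x : ℝ} (hx : x ∈ Icc 0 L) (v : Circle) :
    1 - Real.exp (-(2 * (κ / (v : ℂ).re) * (x - entryPoint L v)))
      ≤ 1 - Real.exp (-(2 * (κ * L) / |(v : ℂ).re|)) := by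
  have := flight_le hκ hx v
  gcongr 1 - Real.exp (-?_)
  rw [mul_assoc, mul_div_assoc]
  linarith

theorem uIoc_entryPoint_subset {x : ℝ} (hx : x ∈ uIcc 0 L) (v : Circle) :
    uIoc (entryPoint L v) x ⊆ uIcc 0 L :=
  uIoc_subset_uIcc.trans (uIcc_subset_uIcc (entryPoint_mem L v) hx)

theorem abs_relaxation_flight_sub_le (hκ : 0 ≤ κ) {x N b : ℝ} {φ : ℝ → ℝ} (hx : x ∈ Icc 0 L)
    (v : Circle) (hN : 0 ≤ N) (hφ : ∀ᵐ y, y ∈ uIcc 0 L → |φ y| ≤ N) :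
    |relaxation (κ / (v : ℂ).re) (entryPoint L v) b φ x -
        Real.exp (-(2 * (κ / (v : ℂ).re) * (x - entryPoint L v))) * b|
      ≤ N / 2 * (1 - Real.exp (-(2 * (κ / (v : ℂ).re) * (x - entryPoint L v)))) := by
  refine abs_relaxation_sub_le (flight_nonneg hκ hx v) ?_ hN
  filter_upwards [hφ] with y h hy
  exact h (uIoc_entryPoint_subset (Icc_subset_uIcc hx) v hy)

theorem abs_relaxation_zero_le (hκ : 0 ≤ κ) {x N : ℝ} {φ : ℝ → ℝ} (hx : x ∈ Icc 0 L)
    (v : Circle) (hN : 0 ≤ N) (hφ : ∀ᵐ y, y ∈ uIcc 0 L → |φ y| ≤ N) :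
    |relaxation (κ / (v : ℂ).re) (entryPoint L v) 0 φ x|
      ≤ N / 2 * (1 - Real.exp (-(2 * (κ * L) / |(v : ℂ).re|))) := by
  have h := abs_relaxation_flight_sub_le (b := 0) hκ hx v hN hφ
  rw [mul_zero, sub_zero] at h
  exact h.trans (mul_le_mul_of_nonneg_left (one_sub_exp_flight_le hκ hx v) (by positivity))

/-- Maximum principle: with `s` the attenuation from the entry point, the solution is bounded by `s
B + (1 - s) (2B)/2`. -/
theorem abs_transport_le (hκ : 0 ≤ κ) {b : Circle → ℝ} {φ : ℝ × Circle → ℝ} {B : ℝ}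
    (hb : ∀ v, |b v| ≤ B) (hφB : ∀ z, |φ z| ≤ 2 * B) {x : ℝ} (hx : x ∈ Icc 0 L) (v : Circle) :
    |transport L κ b φ (x, v)| ≤ B := by
  have hB : 0 ≤ B := (abs_nonneg _).trans (hb v)
  have h := abs_relaxation_flight_sub_le (b := b v) (φ := fun y => φ (y, v)) hκ hx v
    (show 0 ≤ 2 * B by linarith) (ae_of_all _ fun y _ => hφB _)
  rw [transport]
  set s := Real.exp (-(2 * (κ / (v : ℂ).re) * (x - entryPoint L v)))
  have hs : 0 < s := Real.exp_pos _
  have h1 : |s * b v| ≤ s * B := by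
    rw [abs_mul, abs_of_pos hs]
    exact mul_le_mul_of_nonneg_left (hb v) hs.le
  have h2 := abs_add_le (relaxation (κ / (v : ℂ).re) (entryPoint L v) (b v)
    (fun y => φ (y, v)) x - s * b v) (s * b v)
  rw [sub_add_cancel] at h2
  dsimp only
  linarith

theorem intervalIntegrable_of_bounded {f : ℝ → ℝ} {C a b : ℝ} (hf : Measurable f)
    (hC : ∀ x, |f x| ≤ C) : IntervalIntegrable f volume a b := by
  rw [intervalIntegrable_iff]
  exact Measure.integrableOn_of_bounded (M := C) (by simp) hf.aestronglyMeasurable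
    (ae_of_all _ fun x => hC _)

/-- By linearity the difference solves the relaxation equation with the difference of the sources,
and the common incoming data cancel. -/
theorem transport_sub {b : Circle → ℝ} {φ ψ : ℝ × Circle → ℝ} {C : ℝ}
    (hφ : Measurable φ) (hψ : Measurable ψ) (hφC : ∀ z, |φ z| ≤ C) (hψC : ∀ z, |ψ z| ≤ C)
    {x : ℝ} (hx : x ∈ uIcc 0 L) (v : Circle) :
    transport L κ b φ (x, v) - transport L κ b ψ (x, v)
      = relaxation (κ / (v : ℂ).re) (entryPoint L v) 0 (fun y => φ (y, v) - ψ (y, v)) x := by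
  have i1 : IntervalIntegrable (fun y => φ (y, v)) volume 0 L :=
    intervalIntegrable_of_bounded (hφ.comp measurable_prodMk_right) fun y => hφC (y, v)
  have i2 : IntervalIntegrable (fun y => ψ (y, v)) volume 0 L :=
    intervalIntegrable_of_bounded (hψ.comp measurable_prodMk_right) fun y => hψC (y, v)
  have he := entryPoint_mem L v
  have h := eq_relaxation (a := κ / (v : ℂ).re) (e := entryPoint L v)
    ((absolutelyContinuousOnInterval_relaxation (a := κ / (v : ℂ).re) (b := b v) i1 he).fun_sub
      (absolutelyContinuousOnInterval_relaxation (a := κ / (v : ℂ).re) (b := b v) i2 he))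
    (i1.sub i2) he (by
      filter_upwards [hasDerivAt_relaxation (a := κ / (v : ℂ).re) (b := b v) i1 he,
        hasDerivAt_relaxation (a := κ / (v : ℂ).re) (b := b v) i2 he] with y h1 h2 hy
      convert! (h1 hy).sub (h2 hy) using 1
      ring) hx
  simp only [relaxation_self, sub_self] at h
  exact h

/-- One step `φ ↦ K u` of the source iteration, `u` being the solution of the transport problem
with source `φ`. -/
noncomputable def sourceStep (L κ : ℝ) (b : Circle → ℝ) (φ : ℝ × Circle → ℝ) (z : ℝ × Circle) : ℝ :=
  -- Outside `[0, L]` the transport formula satisfies no maximum principle; cutting it off keeps the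
  -- bounds valid at every point, so the iteration is free of null sets.
  (Icc 0 L).indicator (fun x => gain (fun w => transport L κ b φ (x, w)) z.2) z.1

theorem measurable_sourceStep {b : Circle → ℝ} {φ : ℝ × Circle → ℝ} (hb : Measurable b)
    (hφ : Measurable φ) : Measurable (sourceStep L κ b φ) := by
  have h : sourceStep L κ b φ = (Icc 0 L ×ˢ univ).indicator
      fun z => gain (fun w => transport L κ b φ (z.1, w)) z.2 := by
    ext z
    by_cases hz : z.1 ∈ Icc 0 L <;> simp [sourceStep, indicator, mem_prod]
  rw [h]
  exact (measurable_gain (measurable_transport hb hφ)).indicator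
    (measurableSet_Icc.prod MeasurableSet.univ)

theorem abs_sourceStep_le (hκ : 0 ≤ κ) {b : Circle → ℝ} {φ : ℝ × Circle → ℝ} {B : ℝ}
    (hb : ∀ v, |b v| ≤ B) (hφB : ∀ z, |φ z| ≤ 2 * B) (z : ℝ × Circle) :
    |sourceStep L κ b φ z| ≤ 2 * B := by
  rw [sourceStep]
  by_cases hz : z.1 ∈ Icc 0 L
  · rw [indicator_of_mem hz]
    exact abs_gain_le (ae_of_all _ fun ρ => abs_transport_le hκ hb hφB hz _)
  · rw [indicator_of_notMem hz, abs_zero]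
    exact (abs_nonneg _).trans (hφB z)

theorem gain_sub {f g : Circle → ℝ} {v : Circle}
    (hf : IntervalIntegrable (fun ρ => f (scatter v ρ)) volume (-1) 1)
    (hg : IntervalIntegrable (fun ρ => g (scatter v ρ)) volume (-1) 1) :
    gain (fun w => f w - g w) v = gain f v - gain g v :=
  intervalIntegral.integral_sub hf hg

theorem abs_sourceStep_sub_le (hL : 0 ≤ L) (hκ : 0 ≤ κ) {b : Circle → ℝ} {φ ψ : ℝ × Circle → ℝ}
    {B N : ℝ} (hbm : Measurable b) (hb : ∀ v, |b v| ≤ B) (hφ : Measurable φ) (hψ : Measurable ψ)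
    (hφB : ∀ z, |φ z| ≤ 2 * B) (hψB : ∀ z, |ψ z| ≤ 2 * B) (hN : ∀ z, |φ z - ψ z| ≤ N)
    (z : ℝ × Circle) :
    |sourceStep L κ b φ z - sourceStep L κ b ψ z| ≤ (1 - Real.exp (-(4 * (κ * L))) / 5) * N := by
  have hN0 : 0 ≤ N := (abs_nonneg _).trans (hN z)
  have hκL : 0 ≤ κ * L := by positivity
  rw [sourceStep, sourceStep]
  by_cases hz : z.1 ∈ Icc 0 L
  · rw [indicator_of_mem hz, indicator_of_mem hz, ← gain_sub]
    · refine abs_gain_le_of_escape hκL hN0 (ae_of_all _ fun ρ => ?_)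
      rw [transport_sub hφ hψ hφB hψB (Icc_subset_uIcc hz)]
      exact abs_relaxation_zero_le hκ hz _ hN0 (ae_of_all _ fun y _ => hN _)
    · exact intervalIntegrable_comp_scatter
        ((measurable_transport hbm hφ).comp measurable_prodMk_left)
        (fun v => abs_transport_le hκ hb hφB hz v) _
    · exact intervalIntegrable_comp_scatter
        ((measurable_transport hbm hψ).comp measurable_prodMk_left)
        (fun v => abs_transport_le hκ hb hψB hz v) _
  · rw [indicator_of_notMem hz, indicator_of_notMem hz, sub_self, abs_zero]
    have : Real.exp (-(4 * (κ * L))) ≤ 1 := Real.exp_le_one_iff.2 (by linarith)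
    exact mul_nonneg (by linarith) hN0

/-- The iterates from `0` converge geometrically at every point; pointwise limits preserve both
measurability and the bound `2 B`, which is invariant under the step. -/
theorem exists_source_fixedPoint (hL : 0 ≤ L) (hκ : 0 ≤ κ) {b : Circle → ℝ} {B : ℝ}
    (hbm : Measurable b) (hb : ∀ v, |b v| ≤ B) :
    ∃ φ : ℝ × Circle → ℝ, Measurable φ ∧ (∀ z, |φ z| ≤ 2 * B) ∧ sourceStep L κ b φ = φ := by
  have hB : 0 ≤ B := (abs_nonneg _).trans (hb 1)
  set q := 1 - Real.exp (-(4 * (κ * L))) / 5 with hq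
  have hq1 : q < 1 := by linarith [Real.exp_pos (-(4 * (κ * L)))]
  have hq0 : 0 ≤ q := by
    have : Real.exp (-(4 * (κ * L))) ≤ 1 := Real.exp_le_one_iff.2 (by
      have : 0 ≤ κ * L := by positivity
      linarith)
    linarith
  let φ : ℕ → ℝ × Circle → ℝ := fun n => (sourceStep L κ b)^[n] 0
  have hsucc : ∀ n, φ (n + 1) = sourceStep L κ b (φ n) := fun n =>
    Function.iterate_succ_apply' _ _ _
  have hφm : ∀ n, Measurable (φ n) := by
    intro n
    induction n with
    | zero => exact measurable_zero
    | succ n ih => rw [hsucc]; exact measurable_sourceStep hbm ih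
  have hφB : ∀ n z, |φ n z| ≤ 2 * B := by
    intro n
    induction n with
    | zero => intro z; simpa [φ] using hB
    | succ n ih => intro z; rw [hsucc]; exact abs_sourceStep_le hκ hb ih z
  have hdist : ∀ n z, |φ n z - φ (n + 1) z| ≤ 2 * B * q ^ n := by
    intro n
    induction n with
    | zero => intro z; simpa [φ, abs_sub_comm] using hφB 1 z
    | succ n ih =>
      intro z
      rw [hsucc n, hsucc (n + 1)]
      refine (abs_sourceStep_sub_le hL hκ hbm hb (hφm _) (hφm _) (hφB _) (hφB _) ih z).trans ?_
      rw [← hq, pow_succ]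
      exact le_of_eq (by ring)
  have hlim : ∀ z, ∃ l, Tendsto (fun n => φ n z) atTop (𝓝 l) := fun z =>
    cauchySeq_tendsto_of_complete (cauchySeq_of_le_geometric q (2 * B) hq1 fun n => hdist n z)
  choose ψ hψ using hlim
  have hψm : Measurable ψ :=
    measurable_of_tendsto_metrizable hφm (tendsto_pi_nhds.2 hψ)
  have hψB : ∀ z, |ψ z| ≤ 2 * B := fun z =>
    le_of_tendsto (hψ z).abs (Eventually.of_forall fun n => hφB n z)
  have herr : ∀ n z, |φ n z - ψ z| ≤ 2 * B * q ^ n / (1 - q) := fun n z =>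
    dist_le_of_le_geometric_of_tendsto q (2 * B) hq1 (fun n => hdist n z) (hψ z) n
  refine ⟨ψ, hψm, hψB, funext fun z => ?_⟩
  refine tendsto_nhds_unique ?_ ((hψ z).comp (tendsto_add_atTop_nat 1))
  rw [tendsto_iff_dist_tendsto_zero]
  refine squeeze_zero (g := fun n => q * (2 * B * q ^ n / (1 - q))) (fun _ => dist_nonneg)
    (fun n => ?_) ?_
  · rw [Function.comp_apply, hsucc, Real.dist_eq]
    exact abs_sourceStep_sub_le hL hκ hbm hb (hφm _) hψm (hφB _) hψB (herr n) z
  · have := (((tendsto_pow_atTop_nhds_zero_of_lt_one hq0 hq1).const_mul (2 * B)).div_const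
      (1 - q)).const_mul q
    simpa using this

/-- `u` is a bounded measurable solution of `v₁ ∂ₓ u = κ (K u - 2 u)` with incoming data `b`. -/
structure IsSlabSolution (L κ : ℝ) (b : Circle → ℝ) (u : ℝ × Circle → ℝ) (B : ℝ) : Prop where
  measurable : Measurable u
  bound : ∀ x ∈ Icc 0 L, ∀ v, |u (x, v)| ≤ B
  absolutelyContinuous : ∀ v, AbsolutelyContinuousOnInterval (fun x => u (x, v)) 0 L
  hasDerivAt : ∀ v, ∀ᵐ x, x ∈ uIcc 0 L → HasDerivAt (fun x => u (x, v))
    (κ / (v : ℂ).re * (gain (fun w => u (x, w)) v - 2 * u (x, v))) x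
  incoming : ∀ v, u (entryPoint L v, v) = b v

theorem exists_isSlabSolution (hL : 0 ≤ L) (hκ : 0 ≤ κ) {b : Circle → ℝ} {B : ℝ}
    (hbm : Measurable b) (hb : ∀ v, |b v| ≤ B) : ∃ u, IsSlabSolution L κ b u B := by
  obtain ⟨φ, hφm, hφB, hφ⟩ := exists_source_fixedPoint hL hκ hbm hb
  have hi : ∀ v, IntervalIntegrable (fun y => φ (y, v)) volume 0 L := fun v =>
    intervalIntegrable_of_bounded (hφm.comp measurable_prodMk_right) fun y => hφB (y, v)
  have hgain : ∀ x ∈ Icc 0 L, ∀ v, gain (fun w => transport L κ b φ (x, w)) v = φ (x, v) := by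
    intro x hx v
    have h : sourceStep L κ b φ (x, v) = φ (x, v) := by rw [hφ]
    rwa [sourceStep, indicator_of_mem hx] at h
  have hu : ∀ v, (fun x => transport L κ b φ (x, v)) =
      relaxation (κ / (v : ℂ).re) (entryPoint L v) (b v) fun y => φ (y, v) := fun v => rfl
  refine ⟨transport L κ b φ, ⟨measurable_transport hbm hφm,
    fun x hx v => abs_transport_le hκ hb hφB hx v, fun v => ?_, fun v => ?_, fun v => ?_⟩⟩
  · rw [hu]
    exact absolutelyContinuousOnInterval_relaxation (hi v) (entryPoint_mem L v)
  · filter_upwards [hasDerivAt_relaxation (a := κ / (v : ℂ).re) (b := b v) (hi v)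
      (entryPoint_mem L v)] with x h hx
    rw [hgain x (by rwa [uIcc_of_le hL] at hx), hu]
    exact h hx
  · exact relaxation_self _ _ _ _

/-! ### Uniqueness almost everywhere -/

instance (L : ℝ) : IsFiniteMeasure (slabMeasure L) := by unfold slabMeasure; infer_instance

/-- For each fixed `ρ` scattering preserves `dx dv`, so null sets pull back to null sets. This is
what makes the gain insensitive to the choice of representative. -/
theorem ae_scatter_of_ae_slab {p : ℝ × Circle → Prop} (h : ∀ᵐ z ∂slabMeasure L, p z) :
    ∀ᵐ z ∂slabMeasure L, ∀ᵐ ρ ∂volume.restrict (Ioc (-1 : ℝ) 1), p (z.1, scatter z.2 ρ) := by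
  have hm : Measurable fun q : (ℝ × Circle) × ℝ => (q.1.1, scatter q.1.2 q.2) :=
    measurable_fst.fst.prodMk (measurable_scatter.comp (measurable_fst.snd.prodMk measurable_snd))
  have hq : Measure.QuasiMeasurePreserving (fun q : (ℝ × Circle) × ℝ => (q.1.1, scatter q.1.2 q.2))
      ((slabMeasure L).prod (volume.restrict (Ioc (-1 : ℝ) 1))) (slabMeasure L) :=
    QuasiMeasurePreserving.prod_of_left hm (ae_of_all _ fun ρ =>
      ((MeasurePreserving.id _).prod (measurePreserving_scatter ρ)).quasiMeasurePreserving)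
  exact Measure.ae_ae_of_ae_prod (hq.ae h)

theorem ae_ae_of_ae_slab {p : ℝ × Circle → Prop} (h : ∀ᵐ z ∂slabMeasure L, p z) :
    ∀ᵐ v ∂arcLength, ∀ᵐ x ∂volume.restrict (Ioo 0 L), p (x, v) := by
  rw [slabMeasure, ← Measure.prod_swap] at h
  exact Measure.ae_ae_of_ae_prod (ae_of_ae_map measurable_swap.aemeasurable h)

theorem ae_slab_of_ae_ae {p : ℝ × Circle → Prop} (hp : MeasurableSet {z | p z})
    (h : ∀ᵐ v ∂arcLength, ∀ᵐ x ∂volume.restrict (Ioo 0 L), p (x, v)) :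
    ∀ᵐ z ∂slabMeasure L, p z := by
  rw [slabMeasure, ← Measure.prod_swap, ae_map_iff measurable_swap.aemeasurable hp]
  exact (Measure.ae_prod_iff_ae_ae (measurable_swap hp)).2 h

theorem ae_slab_of_forall_Icc {p : ℝ × Circle → Prop} (h : ∀ x ∈ Icc 0 L, ∀ v, p (x, v)) :
    ∀ᵐ z ∂slabMeasure L, p z := by
  have : ∀ᵐ x ∂volume.restrict (Ioo 0 L), x ∈ Icc 0 L := by
    filter_upwards [ae_restrict_mem measurableSet_Ioo] with x hx using Ioo_subset_Icc_self hx
  filter_upwards [Measure.quasiMeasurePreserving_fst.ae this] with z hz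
  exact h z.1 hz z.2

theorem exists_bounded_measurable_ae_eq {h : ℝ × Circle → ℝ} (hh : MemLp h ∞ (slabMeasure L)) :
    ∃ f : ℝ × Circle → ℝ, ∃ C : ℝ, Measurable f ∧ (∀ z, |f z| ≤ C) ∧ f =ᵐ[slabMeasure L] h := by
  obtain ⟨f, hf, hfh⟩ := hh.aestronglyMeasurable
  obtain ⟨C, hC⟩ : ∃ C, ∀ᵐ z ∂slabMeasure L, ‖h z‖ ≤ C := by
    refine ⟨(eLpNorm h ∞ (slabMeasure L)).toReal, ?_⟩
    filter_upwards [ae_le_eLpNormEssSup (f := h) (μ := slabMeasure L)] with z hz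
    rw [← toReal_enorm]
    refine ENNReal.toReal_mono hh.2.ne ?_
    rwa [eLpNorm_exponent_top]
  have hC0 : 0 ≤ max C 0 := le_max_right _ _
  -- Truncating a measurable representative at the essential bound turns the almost-everywhere bound
  -- into one at every point.
  refine ⟨fun z => max (-max C 0) (min (max C 0) (f z)), max C 0,
    measurable_const.max (measurable_const.min hf.measurable), fun z => ?_, ?_⟩
  · rw [abs_le]
    exact ⟨le_max_left _ _, max_le (by linarith) (min_le_left _ _)⟩
  · filter_upwards [hfh, hC] with z h1 h2
    rw [← h1]
    rw [h1, Real.norm_eq_abs, ← h1, abs_le] at h2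
    have := le_max_left C 0
    rw [min_eq_right (by linarith), max_eq_right (by linarith)]

/-- A bound on the source bounds `f` along almost every characteristic; transferring this through
scattering improves the bound on the source by the factor `q`. Iteration forces the source, and then
`f`, to vanish. -/
theorem ae_eq_zero_of_ae_eq_transport (hL : 0 ≤ L) (hκ : 0 ≤ κ) {f : ℝ × Circle → ℝ} {C : ℝ}
    (hf : Measurable f) (hfC : ∀ z, |f z| ≤ C)
    (hft : f =ᵐ[slabMeasure L] transport L κ 0 fun z => gain (fun w => f (z.1, w)) z.2) :
    f =ᵐ[slabMeasure L] 0 := by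
  have hC : 0 ≤ C := (abs_nonneg _).trans (hfC (0, 1))
  have hκL : 0 ≤ κ * L := by positivity
  set φ : ℝ × Circle → ℝ := fun z => gain (fun w => f (z.1, w)) z.2 with hφ
  set q := 1 - Real.exp (-(4 * (κ * L))) / 5 with hq
  have hq1 : q < 1 := by linarith [Real.exp_pos (-(4 * (κ * L)))]
  have hq0 : 0 ≤ q := by
    have : Real.exp (-(4 * (κ * L))) ≤ 1 := Real.exp_le_one_iff.2 (by linarith)
    linarith
  have hbound : ∀ N, 0 ≤ N → (∀ᵐ z ∂slabMeasure L, |φ z| ≤ N) → ∀ᵐ z ∂slabMeasure L,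
      |f z| ≤ N / 2 * (1 - Real.exp (-(2 * (κ * L) / |(z.2 : ℂ).re|))) := by
    intro N hN h
    have hms : MeasurableSet {z : ℝ × Circle |
        |f z| ≤ N / 2 * (1 - Real.exp (-(2 * (κ * L) / |(z.2 : ℂ).re|)))} := by
      have hre : Measurable fun z : ℝ × Circle => |(z.2 : ℂ).re| :=
        (continuous_abs.measurable.comp measurable_circle_re).comp measurable_snd
      exact measurableSet_le (continuous_abs.measurable.comp hf)
        (((hre.const_div _).neg.exp.const_sub 1).const_mul _)
    refine ae_slab_of_ae_ae hms ?_
    filter_upwards [ae_ae_of_ae_slab h, ae_ae_of_ae_slab hft] with v h1 h2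
    filter_upwards [h2, ae_restrict_mem measurableSet_Ioo] with x hx hxL
    rw [hx]
    exact abs_relaxation_zero_le hκ (Ioo_subset_Icc_self hxL) v hN
      (ae_mem_uIcc_of_ae_restrict_Ioo hL h1)
  have hn : ∀ n : ℕ, ∀ᵐ z ∂slabMeasure L, |φ z| ≤ 2 * C * q ^ n := by
    intro n
    induction n with
    | zero =>
      refine ae_of_all _ fun z => ?_
      rw [pow_zero, mul_one]
      exact abs_gain_le (ae_of_all _ fun ρ => hfC _)
    | succ n ih =>
      filter_upwards [ae_scatter_of_ae_slab (hbound _ (by positivity) ih)] with z hz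
      refine (abs_gain_le_of_escape hκL (by positivity) hz).trans (le_of_eq ?_)
      rw [← hq]
      ring
  have h0 : ∀ᵐ z ∂slabMeasure L, |φ z| ≤ 0 := by
    filter_upwards [ae_all_iff.2 hn] with z hz
    have hlim := (tendsto_pow_atTop_nhds_zero_of_lt_one hq0 hq1).const_mul (2 * C)
    rw [mul_zero] at hlim
    exact ge_of_tendsto' hlim hz
  filter_upwards [hbound 0 le_rfl h0] with z hz
  rw [zero_div, zero_mul] at hz
  simpa using hz

theorem gain_congr_ae {f g : Circle → ℝ} {v : Circle}
    (h : ∀ᵐ ρ ∂volume.restrict (Ioc (-1 : ℝ) 1), f (scatter v ρ) = g (scatter v ρ)) :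
    gain f v = gain g v := by
  rw [gain, gain, intervalIntegral.integral_of_le (by norm_num),
    intervalIntegral.integral_of_le (by norm_num)]
  exact integral_congr_ae h

theorem linearBoltzmann_eq_of_ae {μ C : ℝ} {f g : Circle → ℝ} {v : Circle} (hf : Measurable f)
    (hfC : ∀ w, |f w| ≤ C)
    (h : ∀ᵐ ρ ∂volume.restrict (Ioc (-1 : ℝ) 1), f (scatter v ρ) = g (scatter v ρ)) :
    linearBoltzmann μ g v = μ * (gain f v - 2 * g v) := by
  rw [gain_congr_ae h, linearBoltzmann_eq_gain]
  refine (intervalIntegrable_comp_scatter hf hfC v).congr_ae ?_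
  rwa [uIoc_of_le (by norm_num)]

/-- Two versions of each solution are used: `gᵢ` is absolutely continuous along characteristics but
not known to be jointly measurable, while `fᵢ` is bounded and measurable, so the gain is computed
with `fᵢ`. Their difference is a transport solution with zero incoming data. -/
theorem IsStationarySolution.ae_eq {μ η ρ₁ ρ₂ : ℝ} (hL : 0 < L) (hκ : 0 ≤ η * μ)
    {h₁ h₂ : ℝ × Circle → ℝ} (H₁ : IsStationarySolution L μ η ρ₁ ρ₂ h₁)
    (H₂ : IsStationarySolution L μ η ρ₁ ρ₂ h₂) : h₁ =ᵐ[slabMeasure L] h₂ := by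
  obtain ⟨f₁, C₁, hf₁, hC₁, hfh₁⟩ := exists_bounded_measurable_ae_eq H₁.memLp
  obtain ⟨f₂, C₂, hf₂, hC₂, hfh₂⟩ := exists_bounded_measurable_ae_eq H₂.memLp
  obtain ⟨g₁, hgh₁, hg₁⟩ := H₁.exists_representative
  obtain ⟨g₂, hgh₂, hg₂⟩ := H₂.exists_representative
  have hfg₁ : f₁ =ᵐ[slabMeasure L] g₁ := hfh₁.trans hgh₁.symm
  have hfg₂ : f₂ =ᵐ[slabMeasure L] g₂ := hfh₂.trans hgh₂.symm
  set f : ℝ × Circle → ℝ := fun z => f₁ z - f₂ z with hf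
  have hfm : Measurable f := hf₁.sub hf₂
  have hfC : ∀ z, |f z| ≤ C₁ + C₂ := fun z =>
    (abs_sub _ _).trans (add_le_add (hC₁ z) (hC₂ z))
  set φ : ℝ × Circle → ℝ := fun z => gain (fun w => f (z.1, w)) z.2 with hφ
  have hφm : Measurable φ := measurable_gain hfm
  have hφC : ∀ z, |φ z| ≤ 2 * (C₁ + C₂) := fun z => abs_gain_le (ae_of_all _ fun ρ => hfC _)
  have hzero : f =ᵐ[slabMeasure L] 0 := by
    refine ae_eq_zero_of_ae_eq_transport (κ := η * μ) hL.le hκ hfm hfC ?_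
    refine ae_slab_of_ae_ae (measurableSet_eq_fun hfm (measurable_transport measurable_zero hφm)) ?_
    filter_upwards [hg₁, hg₂, ae_ae_of_ae_slab hfg₁, ae_ae_of_ae_slab hfg₂,
      ae_ae_of_ae_slab (ae_scatter_of_ae_slab hfg₁), ae_ae_of_ae_slab (ae_scatter_of_ae_slab hfg₂),
      ae_re_ne_zero] with v ⟨ac₁, d₁, i₁, o₁⟩ ⟨ac₂, d₂, i₂, o₂⟩ e₁ e₂ s₁ s₂ hv
    have hi : IntervalIntegrable (fun y => φ (y, v)) volume 0 L :=
      intervalIntegrable_of_bounded (hφm.comp measurable_prodMk_right) fun y => hφC (y, v)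
    have hd : ∀ᵐ x ∂volume.restrict (Ioo 0 L), HasDerivAt (fun y => g₁ (y, v) - g₂ (y, v))
        (η * μ / (v : ℂ).re * (φ (x, v) - 2 * (g₁ (x, v) - g₂ (x, v)))) x := by
      filter_upwards [d₁, d₂, s₁, s₂] with x ⟨a₁, ha₁, hb₁⟩ ⟨a₂, ha₂, hb₂⟩ t₁ t₂
      convert! ha₁.sub ha₂ using 1
      rw [linearBoltzmann_eq_of_ae (f := fun w => f₁ (x, w)) (g := fun w => g₁ (x, w))
        (hf₁.comp measurable_prodMk_left) (fun w => hC₁ (x, w)) t₁]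
        at hb₁
      rw [linearBoltzmann_eq_of_ae (f := fun w => f₂ (x, w)) (g := fun w => g₂ (x, w))
        (hf₂.comp measurable_prodMk_left) (fun w => hC₂ (x, w)) t₂]
        at hb₂
      have hg : φ (x, v) = gain (fun w => f₁ (x, w)) v - gain (fun w => f₂ (x, w)) v :=
        gain_sub (intervalIntegrable_comp_scatter (hf₁.comp measurable_prodMk_left)
            (fun w => hC₁ (x, w)) v)
          (intervalIntegrable_comp_scatter (hf₂.comp measurable_prodMk_left)
            (fun w => hC₂ (x, w)) v)
      rw [hg]
      field_simp
      linear_combination hb₂ - hb₁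
    have hentry : g₁ (entryPoint L v, v) - g₂ (entryPoint L v, v) = 0 := by
      rw [entryPoint]
      split_ifs with h
      · rw [i₁ h, i₂ h, sub_self]
      · have h' : (v : ℂ).re < 0 := lt_of_le_of_ne (not_lt.1 h) hv
        rw [o₁ h', o₂ h', sub_self]
    filter_upwards [e₁, e₂, ae_restrict_mem measurableSet_Ioo] with x h1 h2 hx
    have key := eq_relaxation (ac₁.fun_sub ac₂) hi (entryPoint_mem L v)
      (ae_mem_uIcc_of_ae_restrict_Ioo hL.le hd) (Icc_subset_uIcc (Ioo_subset_Icc_self hx))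
    rw [hentry] at key
    change f₁ (x, v) - f₂ (x, v) = _
    rw [h1, h2, key]
    rfl
  filter_upwards [hzero, hfh₁, hfh₂] with z h0 h1 h2
  have h0 : f₁ z - f₂ z = 0 := h0
  rw [← h1, ← h2]
  linarith

/-! ### Spectral gap of the collision operator -/

theorem gain_eq_integral_angle (f : Circle → ℝ) (v : Circle) :
    gain f v = ∫ α in (-(π / 2))..(π / 2), Real.cos α * f (Circle.exp (π + 2 * α) * v) := by
  have hpi := Real.pi_pos
  have h := integral_image_eq_integral_abs_deriv_smul (f := Real.sin) (f' := Real.cos)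
    (s := Icc (-(π / 2)) (π / 2)) measurableSet_Icc
    (fun x _ => (Real.hasDerivAt_sin x).hasDerivWithinAt) Real.injOn_sin
    (fun ρ => f (scatter v ρ))
  rw [Real.bijOn_sin.image_eq] at h
  rw [gain, intervalIntegral.integral_of_le (by norm_num), ← integral_Icc_eq_integral_Ioc, h,
    intervalIntegral.integral_of_le (by linarith), ← integral_Icc_eq_integral_Ioc]
  refine setIntegral_congr_fun measurableSet_Icc fun α hα => ?_
  simp only [scatter_eq_rotation, smul_eq_mul]
  rw [abs_of_nonneg (Real.cos_nonneg_of_mem_Icc hα), Real.arcsin_sin hα.1 hα.2]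

/-- As `α` crosses `[-π/2, π/2]`, the angle `π + 2α` covers the circle exactly once, at double
speed. -/
theorem integral_angle {f : Circle → ℝ} (hf : Measurable f) (v : Circle) :
    ∫ α in (-(π / 2))..(π / 2), f (Circle.exp (π + 2 * α) * v)
      = 1 / 2 * ∫ w, f w ∂arcLength := by
  have hm : Measurable fun w : Circle => w * v := (continuous_mul_const v).measurable
  have h1 := intervalIntegral.integral_comp_add_mul (a := -(π / 2)) (b := π / 2)
    (fun t => f (Circle.exp t * v)) two_ne_zero π
  have hper : Function.Periodic (fun t => f (Circle.exp t * v)) (2 * π) :=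
    Circle.periodic_exp.comp fun w => f (w * v)
  have h2 := hper.intervalIntegral_add_eq 0 (-π)
  have h3 : ∫ w, f (w * v) ∂arcLength = ∫ w, f w ∂arcLength := by
    have h := (measurePreserving_rotation (Complex.arg v)).map_eq
    rw [Circle.exp_arg] at h
    have hm' : Measurable fun w : Circle => v * w := (continuous_const_mul v).measurable
    have h4 := integral_map (μ := arcLength) hm'.aemeasurable (f := f) hf.aestronglyMeasurable
    rw [h] at h4
    rw [h4]
    simp_rw [mul_comm]
  rw [h1, ← h3, integral_arcLength (f := fun w => f (w * v)) (hf.comp hm)]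
  rw [show π + 2 * -(π / 2) = 0 by ring, show π + 2 * (π / 2) = 0 + 2 * π by ring, h2,
    show -π + 2 * π = π by ring]
  norm_num

theorem integrable_of_bounded {α : Type*} [MeasurableSpace α] {m : Measure α} [IsFiniteMeasure m]
    {f : α → ℝ} {C : ℝ} (hf : Measurable f) (hC : ∀ᵐ x ∂m, |f x| ≤ C) : Integrable f m :=
  Integrable.of_bound hf.aestronglyMeasurable C hC

/-- In the angle variable the kernel is `cos α ∈ [0, 1]`. Subtracting its midpoint `1/2` leaves a
kernel of size at most `1/2`, and the subtracted part is a multiple of the mean. -/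
theorem abs_gain_sub_quarter_le {f : Circle → ℝ} {C : ℝ} (hf : Measurable f)
    (hC : ∀ v, |f v| ≤ C) (v : Circle) :
    |gain f v - 1 / 4 * ∫ w, f w ∂arcLength| ≤ 1 / 4 * ∫ w, |f w| ∂arcLength := by
  have hpi := Real.pi_pos
  have hexp : Measurable fun α : ℝ => Circle.exp (π + 2 * α) * v := by
    have : Continuous fun α : ℝ => Circle.exp (π + 2 * α) * v := by fun_prop
    exact this.measurable
  have hi : IntervalIntegrable (fun α => f (Circle.exp (π + 2 * α) * v)) volume
      (-(π / 2)) (π / 2) :=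
    intervalIntegrable_of_bounded (hf.comp hexp) fun α => hC _
  have hi2 : IntervalIntegrable (fun α => Real.cos α * f (Circle.exp (π + 2 * α) * v)) volume
      (-(π / 2)) (π / 2) := hi.continuousOn_mul Real.continuous_cos.continuousOn
  have h1 : gain f v - 1 / 4 * ∫ w, f w ∂arcLength = ∫ α in (-(π / 2))..(π / 2),
      (Real.cos α * f (Circle.exp (π + 2 * α) * v)
        - 1 / 2 * f (Circle.exp (π + 2 * α) * v)) := by
    rw [intervalIntegral.integral_sub hi2 (hi.const_mul _), intervalIntegral.integral_const_mul,
      integral_angle hf, gain_eq_integral_angle]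
    ring
  have h2 : 1 / 4 * ∫ w, |f w| ∂arcLength = ∫ α in (-(π / 2))..(π / 2),
      1 / 2 * |f (Circle.exp (π + 2 * α) * v)| := by
    rw [intervalIntegral.integral_const_mul,
      integral_angle (f := fun w => |f w|) (continuous_abs.measurable.comp hf)]
    ring
  rw [h1, h2]
  have hle : ∀ᵐ α : ℝ, α ∈ Ioc (-(π / 2)) (π / 2) →
      ‖Real.cos α * f (Circle.exp (π + 2 * α) * v) - 1 / 2 * f (Circle.exp (π + 2 * α) * v)‖
        ≤ 1 / 2 * |f (Circle.exp (π + 2 * α) * v)| := by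
    refine ae_of_all _ fun α hα => ?_
    rw [← sub_mul, Real.norm_eq_abs, abs_mul]
    gcongr
    have h3 := Real.cos_nonneg_of_mem_Icc (Ioc_subset_Icc_self hα)
    have h4 := Real.cos_le_one α
    rw [abs_le]
    constructor <;> linarith
  exact intervalIntegral.norm_integral_le_of_norm_le (by linarith) hle (hi.abs.const_mul _)

theorem measurable_gain_apply {f : Circle → ℝ} (hf : Measurable f) : Measurable (gain f) := by
  have := measurable_gain (α := Unit) (f := fun z => f z.2) (hf.comp measurable_snd)
  exact this.comp (measurable_const (a := ()).prodMk measurable_id)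

theorem integral_gain {f : Circle → ℝ} {C : ℝ} (hf : Measurable f) (hC : ∀ v, |f v| ≤ C) :
    ∫ v, gain f v ∂arcLength = 2 * ∫ v, f v ∂arcLength := by
  have hint : Integrable (Function.uncurry fun (v : Circle) (ρ : ℝ) => f (scatter v ρ))
      (arcLength.prod (volume.restrict (Ioc (-1 : ℝ) 1))) :=
    integrable_of_bounded (C := C) (hf.comp measurable_scatter) (ae_of_all _ fun _ => hC _)
  have h1 : ∀ ρ : ℝ, ∫ v, f (scatter v ρ) ∂arcLength = ∫ v, f v ∂arcLength := by
    intro ρ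
    have h := integral_map (μ := arcLength) (measurePreserving_scatter ρ).measurable.aemeasurable
      (f := f) hf.aestronglyMeasurable
    rw [(measurePreserving_scatter ρ).map_eq] at h
    exact h.symm
  simp_rw [gain, intervalIntegral.integral_of_le (show (-1 : ℝ) ≤ 1 by norm_num)]
  rw [integral_integral_swap hint]
  simp_rw [h1]
  simp
  norm_num

theorem gain_const (m : ℝ) (v : Circle) : gain (fun _ => m) v = 2 * m := by
  rw [gain, intervalIntegral.integral_const, smul_eq_mul]
  norm_num

/-- Cauchy–Schwarz, from the non-negative variance of `|f|`. -/
theorem sq_integral_abs_le {f : Circle → ℝ} {C : ℝ} (hf : Measurable f) (hC : ∀ v, |f v| ≤ C) :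
    (∫ v, |f v| ∂arcLength) ^ 2 ≤ 2 * π * ∫ v, f v ^ 2 ∂arcLength := by
  have hpi := Real.pi_pos
  set I := ∫ v, |f v| ∂arcLength with hI
  have i1 : Integrable (fun v => |f v|) arcLength :=
    integrable_of_bounded (C := C) (continuous_abs.measurable.comp hf)
      (ae_of_all _ fun v => by rw [abs_abs]; exact hC v)
  have i2 : Integrable (fun v => f v ^ 2) arcLength :=
    integrable_of_bounded (C := C ^ 2) (hf.pow_const 2) (ae_of_all _ fun v => by
      rw [abs_pow]; exact pow_le_pow_left₀ (abs_nonneg _) (hC v) 2)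
  have h0 : 0 ≤ ∫ v, (|f v| - I / (2 * π)) ^ 2 ∂arcLength := integral_nonneg fun v => sq_nonneg _
  have h1 : ∀ v, (|f v| - I / (2 * π)) ^ 2
      = f v ^ 2 - I / π * |f v| + (I / (2 * π)) ^ 2 := by
    intro v
    rw [sub_sq, sq_abs]
    field_simp
  simp_rw [h1] at h0
  have i3 : Integrable (fun v => f v ^ 2 - I / π * |f v|) arcLength := i2.sub (i1.const_mul _)
  rw [integral_add i3 (integrable_const _),
    integral_sub i2 (i1.const_mul _), integral_const_mul, integral_const,
    measureReal_arcLength_univ, ← hI, smul_eq_mul] at h0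
  have h2 : ∫ v, f v ^ 2 ∂arcLength - I / π * I + 2 * π * (I / (2 * π)) ^ 2
      = ∫ v, f v ^ 2 ∂arcLength - I ^ 2 / (2 * π) := by
    field_simp
    ring
  rw [h2, sub_nonneg, div_le_iff₀ (by positivity)] at h0
  linarith

/-- Coercivity of `-𝓛` on functions of zero mean. -/
theorem dissipation_ge {f : Circle → ℝ} {C : ℝ} (hf : Measurable f) (hC : ∀ v, |f v| ≤ C) :
    (2 - π / 2) * ∫ v, (f v - (2 * π)⁻¹ * ∫ w, f w ∂arcLength) ^ 2 ∂arcLength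
      ≤ ∫ v, f v * (2 * f v - gain f v) ∂arcLength := by
  have hpi := Real.pi_pos
  set m := (2 * π)⁻¹ * ∫ w, f w ∂arcLength with hm
  set f₀ : Circle → ℝ := fun v => f v - m with hf₀
  have hf₀m : Measurable f₀ := hf.sub_const m
  have hf₀C : ∀ v, |f₀ v| ≤ C + |m| := fun v =>
    (abs_sub _ _).trans (by linarith [hC v])
  set D := C + |m|
  have hD : 0 ≤ D := (abs_nonneg _).trans (hf₀C 1)
  have hgm : Measurable (gain f₀) := measurable_gain_apply hf₀m
  have hgC : ∀ v, |gain f₀ v| ≤ 2 * D := fun v => abs_gain_le (ae_of_all _ fun ρ => hf₀C _)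
  have i0 : Integrable f₀ arcLength := integrable_of_bounded hf₀m (ae_of_all _ hf₀C)
  have ig : Integrable (gain f₀) arcLength := integrable_of_bounded hgm (ae_of_all _ hgC)
  have ia : Integrable (fun v => |f₀ v|) arcLength := i0.abs
  have i2 : Integrable (fun v => f₀ v ^ 2) arcLength :=
    integrable_of_bounded (C := D ^ 2) (hf₀m.pow_const 2) (ae_of_all _ fun v => by
      rw [abs_pow]; exact pow_le_pow_left₀ (abs_nonneg _) (hf₀C v) 2)
  have ifg : Integrable (fun v => f₀ v * gain f₀ v) arcLength :=
    integrable_of_bounded (C := D * (2 * D)) (hf₀m.mul hgm) (ae_of_all _ fun v => by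
      rw [abs_mul]; exact mul_le_mul (hf₀C v) (hgC v) (abs_nonneg _) hD)
  have hmean : ∫ v, f₀ v ∂arcLength = 0 := by
    rw [hf₀, integral_sub (integrable_of_bounded hf (ae_of_all _ hC)) (integrable_const _),
      integral_const, measureReal_arcLength_univ, hm, smul_eq_mul]
    field_simp
    ring
  have hgain : ∀ v, gain f v = gain f₀ v + 2 * m := by
    intro v
    have : gain f₀ v = gain f v - gain (fun _ => m) v :=
      gain_sub (intervalIntegrable_comp_scatter hf hC v) (by simp)
    rw [this, gain_const]
    ring
  have hsplit : ∀ v, f v * (2 * f v - gain f v)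
      = (2 * f₀ v ^ 2 - f₀ v * gain f₀ v) + m * (2 * f₀ v - gain f₀ v) := by
    intro v
    rw [hgain, show f v = f₀ v + m by simp [hf₀]]
    ring
  -- On zero mean, `⟨f₀, K f₀⟩ ≤ (1/4) (∫ |f₀|)² ≤ (2π/4) ∫ f₀²`. Since `π/2 < 2`, this leaves a
  -- positive gap.
  have hcross : ∫ v, f₀ v * gain f₀ v ∂arcLength ≤ π / 2 * ∫ v, f₀ v ^ 2 ∂arcLength := by
    have h1 : ∫ v, f₀ v * gain f₀ v ∂arcLength
        ≤ ∫ v, |f₀ v| * (1 / 4 * ∫ w, |f₀ w| ∂arcLength) ∂arcLength := by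
      refine integral_mono ifg (ia.mul_const _) fun v => ?_
      have h2 := abs_gain_sub_quarter_le hf₀m hf₀C v
      rw [hmean, mul_zero, sub_zero] at h2
      exact (le_abs_self _).trans (by
        rw [abs_mul]; exact mul_le_mul_of_nonneg_left h2 (abs_nonneg _))
    rw [integral_mul_const] at h1
    have h3 := sq_integral_abs_le hf₀m hf₀C
    nlinarith
  simp_rw [hsplit]
  have j1 : Integrable (fun v => 2 * f₀ v ^ 2 - f₀ v * gain f₀ v) arcLength :=
    (i2.const_mul 2).sub ifg
  have j2 : Integrable (fun v => m * (2 * f₀ v - gain f₀ v)) arcLength :=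
    ((i0.const_mul 2).sub ig).const_mul m
  -- The terms linear in `m` integrate to zero, because `K` doubles the total mass and `f₀` has
  -- none.
  rw [integral_add j1 j2,
    integral_sub (i2.const_mul 2) ifg, integral_const_mul, integral_const_mul,
    integral_sub (i0.const_mul 2) ig, integral_const_mul, integral_gain hf₀m hf₀C, hmean]
  linarith

/-! ### Energy estimate for the velocity fluctuation -/

theorem eLpNorm_two_le_of_integral_sq_le {α : Type*} [MeasurableSpace α] {m : Measure α}
    {f : α → ℝ} {D : ℝ} (hf : AEStronglyMeasurable f m) (hi : Integrable (fun x => f x ^ 2) m)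
    (hD : ∫ x, f x ^ 2 ∂m ≤ D) : eLpNorm f 2 m ≤ ENNReal.ofReal (√D) := by
  have hmem : MemLp f 2 m := (memLp_two_iff_integrable_sq hf).2 hi
  rw [hmem.eLpNorm_eq_integral_rpow_norm two_ne_zero (by simp)]
  refine ENNReal.ofReal_le_ofReal ?_
  simp only [ENNReal.toReal_ofNat, Real.rpow_two, Real.norm_eq_abs, sq_abs]
  rw [← one_div, ← Real.sqrt_eq_rpow]
  exact Real.sqrt_le_sqrt hD

theorem measurable_velocityAverage {u : ℝ × Circle → ℝ} (hu : Measurable u) :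
    Measurable (velocityAverage u) :=
  (hu.stronglyMeasurable.integral_prod_right' (ν := arcLength)).measurable.const_mul _

theorem abs_velocityAverage_le {u : ℝ × Circle → ℝ} {x B : ℝ} (hB : ∀ v, |u (x, v)| ≤ B) :
    |velocityAverage u x| ≤ B := by
  have hpi := Real.pi_pos
  have h := norm_integral_le_of_norm_le_const (μ := arcLength) (f := fun v => u (x, v)) (C := B)
    (ae_of_all _ hB)
  rw [measureReal_arcLength_univ, Real.norm_eq_abs] at h
  rw [velocityAverage, abs_mul, abs_of_pos (by positivity : (0 : ℝ) < (2 * π)⁻¹),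
    inv_mul_le_iff₀ (by positivity)]
  linarith

theorem velocityAverage_congr_ae {u w : ℝ × Circle → ℝ} (h : u =ᵐ[slabMeasure L] w) :
    ∀ᵐ z ∂slabMeasure L, velocityAverage u z.1 = velocityAverage w z.1 := by
  have h1 : ∀ᵐ x ∂volume.restrict (Ioo 0 L), velocityAverage u x = velocityAverage w x := by
    filter_upwards [Measure.ae_ae_of_ae_prod h] with x hx
    rw [velocityAverage, velocityAverage, integral_congr_ae hx]
  exact Measure.quasiMeasurePreserving_fst.ae h1

namespace IsSlabSolution

variable {b : Circle → ℝ} {u : ℝ × Circle → ℝ} {B : ℝ}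

theorem ae_bound (hu : IsSlabSolution L κ b u B) : ∀ᵐ z ∂slabMeasure L, |u z| ≤ B :=
  ae_slab_of_forall_Icc hu.bound

theorem measurable_section (hu : IsSlabSolution L κ b u B) (x : ℝ) :
    Measurable fun v => u (x, v) :=
  hu.measurable.comp measurable_prodMk_left

/-- By the energy identity, `2κ` times the left side is `v₁ (u(0,v)² - u(L,v)²)`. The outgoing end
contributes with a favourable sign and the incoming end at most `|v₁| B² ≤ B²`. -/
theorem integral_dissipation_le (hu : IsSlabSolution L κ b u B) (hL : 0 ≤ L) (hκ : 0 < κ)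
    {v : Circle} (hv : (v : ℂ).re ≠ 0) :
    ∫ x in Ioo 0 L, u (x, v) * (2 * u (x, v) - gain (fun w => u (x, w)) v) ≤ B ^ 2 / (2 * κ) := by
  have h := sq_sub_sq_eq_integral (hu.absolutelyContinuous v) (hu.hasDerivAt v)
  rw [intervalIntegral.integral_of_le hL, integral_Ioc_eq_integral_Ioo] at h
  set I := ∫ x in Ioo 0 L, u (x, v) * (2 * u (x, v) - gain (fun w => u (x, w)) v)
  have h0 : u (0, v) ^ 2 ≤ B ^ 2 := sq_le_sq' (abs_le.1 (hu.bound 0 ⟨le_rfl, hL⟩ v)).1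
    (abs_le.1 (hu.bound 0 ⟨le_rfl, hL⟩ v)).2
  have h1 : u (L, v) ^ 2 ≤ B ^ 2 := sq_le_sq' (abs_le.1 (hu.bound L ⟨hL, le_rfl⟩ v)).1
    (abs_le.1 (hu.bound L ⟨hL, le_rfl⟩ v)).2
  have hre := abs_le.1 (abs_re_le_one v)
  have h2 : 2 * κ * I = (v : ℂ).re * (u (0, v) ^ 2 - u (L, v) ^ 2) := by
    field_simp at h
    linarith
  rw [le_div_iff₀ (by positivity), mul_comm, h2]
  rcases lt_or_gt_of_ne hv with hneg | hpos
  · nlinarith [sq_nonneg (u (0, v)), sq_nonneg (u (L, v))]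
  · nlinarith [sq_nonneg (u (0, v)), sq_nonneg (u (L, v))]

theorem integral_sq_sub_average_le (hu : IsSlabSolution L κ b u B) (hL : 0 ≤ L) (hκ : 0 < κ) :
    Integrable (fun z => (u z - velocityAverage u z.1) ^ 2) (slabMeasure L) ∧
    ∫ z, (u z - velocityAverage u z.1) ^ 2 ∂slabMeasure L ≤ π * B ^ 2 / (κ * (2 - π / 2)) := by
  have hpi := Real.pi_pos
  have hpi4 : 0 < 2 - π / 2 := by linarith [Real.pi_lt_four]
  have hB : 0 ≤ B := (abs_nonneg _).trans (hu.bound 0 ⟨le_rfl, hL⟩ 1)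
  set G : ℝ × Circle → ℝ := fun z => u z * (2 * u z - gain (fun w => u (z.1, w)) z.2) with hG
  set W : ℝ × Circle → ℝ := fun z => (u z - velocityAverage u z.1) ^ 2 with hW
  have hGm : Measurable G :=
    hu.measurable.mul ((hu.measurable.const_mul 2).sub (measurable_gain hu.measurable))
  have hWm : Measurable W :=
    (hu.measurable.sub ((measurable_velocityAverage hu.measurable).comp measurable_fst)).pow_const 2
  have hGi : Integrable G (slabMeasure L) := by
    refine integrable_of_bounded (C := B * (2 * B + 2 * B)) hGm
      (ae_slab_of_forall_Icc fun x hx v => ?_)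
    rw [abs_mul]
    refine mul_le_mul (hu.bound x hx v) ((abs_sub _ _).trans (add_le_add ?_ ?_))
      (abs_nonneg _) hB
    · rw [abs_mul, abs_two]
      linarith [hu.bound x hx v]
    · exact abs_gain_le (ae_of_all _ fun ρ => hu.bound x hx _)
  have hWi : Integrable W (slabMeasure L) := by
    refine integrable_of_bounded (C := (B + B) ^ 2) hWm
      (ae_slab_of_forall_Icc fun x hx v => ?_)
    rw [abs_pow]
    exact pow_le_pow_left₀ (abs_nonneg _) ((abs_sub _ _).trans
      (add_le_add (hu.bound x hx v) (abs_velocityAverage_le (hu.bound x hx)))) 2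
  refine ⟨hWi, ?_⟩
  rw [slabMeasure] at hGi hWi
  have h1 : ∫ z, G z ∂slabMeasure L ≤ π * B ^ 2 / κ := by
    rw [slabMeasure, integral_prod_symm G hGi]
    calc ∫ v, (∫ x in Ioo 0 L, G (x, v)) ∂arcLength
        ≤ ∫ _ : Circle, B ^ 2 / (2 * κ) ∂arcLength := by
          refine integral_mono_ae hGi.integral_prod_right (integrable_const _) ?_
          filter_upwards [ae_re_ne_zero] with v hv
          exact hu.integral_dissipation_le hL hκ hv
      _ = π * B ^ 2 / κ := by
          rw [integral_const, measureReal_arcLength_univ, smul_eq_mul]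
          field_simp
  have h2 : (2 - π / 2) * ∫ z, W z ∂slabMeasure L ≤ ∫ z, G z ∂slabMeasure L := by
    rw [slabMeasure, integral_prod W hWi, integral_prod G hGi, ← integral_const_mul]
    refine integral_mono_ae (hWi.integral_prod_left.const_mul _) hGi.integral_prod_left ?_
    filter_upwards [ae_restrict_mem measurableSet_Ioo] with x hx
    exact dissipation_ge (hu.measurable_section x) (hu.bound x (Ioo_subset_Icc_self hx))
  rw [le_div_iff₀ (by positivity)]
  rw [le_div_iff₀ hκ] at h1
  nlinarith

end IsSlabSolution

end Slab

/-! ### The corrector and the exact expansion -/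

/-- The explicit first corrector, a multiple of `v₁`. -/
noncomputable def firstCorrector (L μ ρ₁ ρ₂ : ℝ) (v : Circle) : ℝ :=
  -(3 / (8 * μ) * ((ρ₂ - ρ₁) / L)) * (v : ℂ).re

theorem measurable_firstCorrector (L μ ρ₁ ρ₂ : ℝ) : Measurable (firstCorrector L μ ρ₁ ρ₂) :=
  measurable_circle_re.const_mul _

theorem abs_firstCorrector_le (L μ ρ₁ ρ₂ : ℝ) (v : Circle) :
    |firstCorrector L μ ρ₁ ρ₂ v| ≤ |3 / (8 * μ) * ((ρ₂ - ρ₁) / L)| := by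
  rw [firstCorrector, abs_mul, abs_neg]
  exact mul_le_of_le_one_right (abs_nonneg _) (abs_re_le_one v)

/-- Hence `𝓛` multiplies it by `-(8/3) μ`, which explains the constant `3 / (8 μ)` in its
definition. -/
theorem gain_firstCorrector (L μ ρ₁ ρ₂ : ℝ) (v : Circle) :
    gain (firstCorrector L μ ρ₁ ρ₂) v = -(2 / 3) * firstCorrector L μ ρ₁ ρ₂ v := by
  have h := gain_re v
  rw [gain] at h ⊢
  simp only [firstCorrector]
  rw [intervalIntegral.integral_const_mul, h]
  ring

theorem isFirstCorrector_firstCorrector {L μ : ℝ} (hμ : 0 < μ) (ρ₁ ρ₂ : ℝ) :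
    IsFirstCorrector L μ ρ₁ ρ₂ (firstCorrector L μ ρ₁ ρ₂) where
  memLp := memLp_top_of_bound (measurable_firstCorrector L μ ρ₁ ρ₂).aestronglyMeasurable _
    (ae_of_all _ (abs_firstCorrector_le L μ ρ₁ ρ₂))
  integral_eq_zero := by
    have h := integral_gain (measurable_firstCorrector L μ ρ₁ ρ₂) (abs_firstCorrector_le L μ ρ₁ ρ₂)
    simp_rw [gain_firstCorrector, integral_const_mul] at h
    linarith
  equation := ae_of_all _ fun v => by
    rw [linearBoltzmann_eq_gain (intervalIntegrable_comp_scatter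
      (measurable_firstCorrector L μ ρ₁ ρ₂) (abs_firstCorrector_le L μ ρ₁ ρ₂) v),
      gain_firstCorrector, firstCorrector]
    field_simp
    ring

theorem abs_linearProfile_le {L ρ₁ ρ₂ x : ℝ} (hx : x ∈ Icc 0 L) :
    |linearProfile L ρ₁ ρ₂ x| ≤ |ρ₁| + |ρ₂| := by
  have hL : 0 ≤ L := hx.1.trans hx.2
  rcases hL.eq_or_lt with h | h
  · rw [linearProfile, ← h, div_zero, abs_zero]
    positivity
  rw [linearProfile, abs_div, abs_of_pos h, div_le_iff₀ h]
  refine (abs_add_le _ _).trans ?_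
  rw [abs_mul, abs_mul, abs_of_nonneg hx.1, abs_of_nonneg (sub_nonneg.2 hx.2)]
  nlinarith [hx.1, hx.2, abs_nonneg ρ₁, abs_nonneg ρ₂]

theorem hasDerivAt_linearProfile (L ρ₁ ρ₂ x : ℝ) :
    HasDerivAt (linearProfile L ρ₁ ρ₂) ((ρ₂ - ρ₁) / L) x := by
  have h := ((((hasDerivAt_id x).const_sub L).const_mul ρ₁).add
    ((hasDerivAt_id x).const_mul ρ₂)).div_const L
  convert! h using 1
  ring

/-- The function `ϱ^S + η⁻¹ h₁ + η⁻¹ R`. -/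
noncomputable def hilbertExpansion (L η ρ₁ ρ₂ : ℝ) (h₁ : Circle → ℝ) (R : ℝ × Circle → ℝ)
    (z : ℝ × Circle) : ℝ :=
  linearProfile L ρ₁ ρ₂ z.1 + (h₁ z.2 + R z) / η

theorem hilbertRemainder_hilbertExpansion {L η ρ₁ ρ₂ : ℝ} (hη : η ≠ 0) (h₁ : Circle → ℝ)
    (R : ℝ × Circle → ℝ) :
    hilbertRemainder L η ρ₁ ρ₂ h₁ (hilbertExpansion L η ρ₁ ρ₂ h₁ R) = R := by
  ext z
  rw [hilbertRemainder, hilbertExpansion]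
  field_simp
  ring

theorem gain_hilbertExpansion {L η ρ₁ ρ₂ B C x : ℝ} {h₁ : Circle → ℝ} {R : ℝ × Circle → ℝ}
    (hm : Measurable h₁) (hC : ∀ v, |h₁ v| ≤ C) (hR : Measurable R) (hB : ∀ v, |R (x, v)| ≤ B)
    (v : Circle) :
    gain (fun w => hilbertExpansion L η ρ₁ ρ₂ h₁ R (x, w)) v =
      2 * linearProfile L ρ₁ ρ₂ x + (gain h₁ v + gain (fun w => R (x, w)) v) / η := by
  have i1 := intervalIntegrable_comp_scatter hm hC v
  have i2 := intervalIntegrable_comp_scatter (f := fun w => R (x, w))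
    (hR.comp measurable_prodMk_left) hB v
  simp only [gain, hilbertExpansion]
  rw [intervalIntegral.integral_add intervalIntegrable_const ((i1.add i2).div_const η),
    intervalIntegral.integral_div, intervalIntegral.integral_add i1 i2,
    intervalIntegral.integral_const, smul_eq_mul]
  norm_num

/-- The source `v₁ ∂ₓ ϱ^S` is cancelled exactly by `𝓛 h₁`, and `𝓛` kills `ϱ^S`. The incoming data
`-h₁` of `R` restore the values `ρ₁` and `ρ₂`. -/
theorem isStationarySolution_hilbertExpansion {L μ η ρ₁ ρ₂ B : ℝ} (hL : 0 < L) (hμ : 0 < μ)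
    (hη : 0 < η) {R : ℝ × Circle → ℝ}
    (hR : IsSlabSolution L (η * μ) (fun v => -firstCorrector L μ ρ₁ ρ₂ v) R B) :
    IsStationarySolution L μ η ρ₁ ρ₂
      (hilbertExpansion L η ρ₁ ρ₂ (firstCorrector L μ ρ₁ ρ₂) R) := by
  set h₁ := firstCorrector L μ ρ₁ ρ₂ with hh₁
  have hm : Measurable h₁ := measurable_firstCorrector L μ ρ₁ ρ₂
  have hC : ∀ v, |h₁ v| ≤ |3 / (8 * μ) * ((ρ₂ - ρ₁) / L)| := abs_firstCorrector_le L μ ρ₁ ρ₂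
  set C := |3 / (8 * μ) * ((ρ₂ - ρ₁) / L)|
  have hpc : Continuous (linearProfile L ρ₁ ρ₂) := by
    unfold linearProfile
    fun_prop
  have hHm : Measurable (hilbertExpansion L η ρ₁ ρ₂ h₁ R) :=
    (hpc.measurable.comp measurable_fst).add
      (((hm.comp measurable_snd).add hR.measurable).div_const η)
  have hHb : ∀ x ∈ Icc 0 L, ∀ v, |hilbertExpansion L η ρ₁ ρ₂ h₁ R (x, v)|
      ≤ |ρ₁| + |ρ₂| + (C + B) / η := by
    intro x hx v
    rw [hilbertExpansion]
    refine (abs_add_le _ _).trans (add_le_add (abs_linearProfile_le hx) ?_)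
    rw [abs_div, abs_of_pos hη]
    gcongr
    exact (abs_add_le _ _).trans (add_le_add (hC v) (hR.bound x hx v))
  refine ⟨memLp_top_of_bound hHm.aestronglyMeasurable _ (ae_slab_of_forall_Icc hHb),
    hilbertExpansion L η ρ₁ ρ₂ h₁ R, EventuallyEq.rfl, ?_⟩
  filter_upwards [ae_re_ne_zero] with v hv
  refine ⟨?_, ?_, fun hpos => ?_, fun hneg => ?_⟩
  · have a1 : AbsolutelyContinuousOnInterval (linearProfile L ρ₁ ρ₂) 0 L := by
      apply ContDiffOn.absolutelyContinuousOnInterval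
      apply ContDiff.contDiffOn
      unfold linearProfile
      fun_prop
    have a2 : AbsolutelyContinuousOnInterval (fun _ : ℝ => h₁ v) 0 L :=
      contDiff_const.contDiffOn.absolutelyContinuousOnInterval
    have a3 := a1.fun_add ((a2.fun_add (hR.absolutelyContinuous v)).const_mul η⁻¹)
    convert! a3 using 2 with x
    rw [hilbertExpansion, div_eq_inv_mul]
  · have hd := ae_restrict_Ioo_of_ae_mem_uIcc hL.le (hR.hasDerivAt v)
    filter_upwards [hd, ae_restrict_mem measurableSet_Ioo] with x hx hxL
    have hx' : x ∈ Icc 0 L := Ioo_subset_Icc_self hxL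
    refine ⟨_, (hasDerivAt_linearProfile L ρ₁ ρ₂ x).add ((hx.const_add (h₁ v)).div_const η), ?_⟩
    rw [linearBoltzmann_eq_gain (intervalIntegrable_comp_scatter
        (f := fun w => hilbertExpansion L η ρ₁ ρ₂ h₁ R (x, w))
        (hHm.comp measurable_prodMk_left) (hHb x hx') v),
      gain_hilbertExpansion hm hC hR.measurable (hR.bound x hx'), hh₁, gain_firstCorrector,
      hilbertExpansion, firstCorrector]
    field_simp
    ring
  · have h := hR.incoming v
    rw [entryPoint, if_pos hpos] at h
    rw [hilbertExpansion, h, linearProfile]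
    field_simp
    ring
  · have h := hR.incoming v
    rw [entryPoint, if_neg hneg.not_gt] at h
    rw [hilbertExpansion, h, linearProfile]
    field_simp
    ring

/-- A solution of the stationary problem that differs from the linear profile by `η⁻¹` times a
bounded function, together with the bounds on its remainder. -/
theorem exists_stationarySolution {L μ : ℝ} (ρ₁ ρ₂ : ℝ) (hL : 0 < L) (hμ : 0 < μ) {η B : ℝ}
    (hη : 0 < η) (hB : B = |3 / (8 * μ) * ((ρ₂ - ρ₁) / L)|) :
    ∃ H R : ℝ × Circle → ℝ, IsStationarySolution L μ η ρ₁ ρ₂ H ∧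
      hilbertRemainder L η ρ₁ ρ₂ (firstCorrector L μ ρ₁ ρ₂) H = R ∧
      (∀ᵐ z ∂slabMeasure L, |R z| ≤ B) ∧
      eLpNorm (fun z => R z - velocityAverage R z.1) 2 (slabMeasure L)
        ≤ ENNReal.ofReal (√(π * B ^ 2 / (μ * (2 - π / 2))) * η ^ (-(1 / 2) : ℝ)) := by
  obtain ⟨R, hR⟩ := exists_isSlabSolution (κ := η * μ) hL.le (by positivity)
    (measurable_firstCorrector L μ ρ₁ ρ₂).neg (B := B) (fun v => by
      rw [hB, Pi.neg_apply, abs_neg]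
      exact abs_firstCorrector_le L μ ρ₁ ρ₂ v)
  refine ⟨_, R, isStationarySolution_hilbertExpansion hL hμ hη hR,
    hilbertRemainder_hilbertExpansion hη.ne' _ _, hR.ae_bound, ?_⟩
  obtain ⟨hi, hle⟩ := hR.integral_sq_sub_average_le hL.le (by positivity)
  have hm : Measurable fun z : ℝ × Circle => R z - velocityAverage R z.1 :=
    hR.measurable.sub ((measurable_velocityAverage hR.measurable).comp measurable_fst)
  refine (eLpNorm_two_le_of_integral_sq_le hm.aestronglyMeasurable hi hle).trans_eq ?_
  have hpi4 : 0 < 2 - π / 2 := by linarith [Real.pi_lt_four]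
  rw [Real.rpow_neg hη.le, ← Real.sqrt_eq_rpow, ← Real.sqrt_inv,
    ← Real.sqrt_mul (by have := Real.pi_pos; positivity)]
  congr 2
  field_simp

/-! ### Conclusion -/

theorem mainTheorem8 (L μ ρ₁ ρ₂ : ℝ) (hL : 0 < L) (hμ : 0 < μ) (hρ₁ : 0 < ρ₁) (hρ₂ : 0 < ρ₂)
    (η : ℝ → ℝ) (hη : Tendsto η (𝓝[>] 0) atTop) :
    (∀ᶠ ε in 𝓝[>] (0 : ℝ), ∃ h : ℝ × Circle → ℝ,
      IsStationarySolution L μ (η ε) ρ₁ ρ₂ h ∧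
      ∀ g : ℝ × Circle → ℝ, IsStationarySolution L μ (η ε) ρ₁ ρ₂ g → g =ᵐ[slabMeasure L] h) ∧
    ∀ h : ℝ → ℝ × Circle → ℝ,
      (∀ᶠ ε in 𝓝[>] (0 : ℝ), IsStationarySolution L μ (η ε) ρ₁ ρ₂ (h ε)) →
      Tendsto (fun ε => eLpNorm (fun z => h ε z - linearProfile L ρ₁ ρ₂ z.1) 2 (slabMeasure L))
        (𝓝[>] 0) (𝓝 0) ∧
      ∃ h₁ : Circle → ℝ, IsFirstCorrector L μ ρ₁ ρ₂ h₁ ∧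
        ∃ C : ℝ, ∀ᶠ ε in 𝓝[>] (0 : ℝ),
          eLpNorm (hilbertRemainder L (η ε) ρ₁ ρ₂ h₁ (h ε)) 2 (slabMeasure L)
            ≤ ENNReal.ofReal C ∧
          eLpNorm (fun z => hilbertRemainder L (η ε) ρ₁ ρ₂ h₁ (h ε) z -
              velocityAverage (hilbertRemainder L (η ε) ρ₁ ρ₂ h₁ (h ε)) z.1) 2 (slabMeasure L)
            ≤ ENNReal.ofReal (C * (η ε) ^ (-(1 / 2) : ℝ)) := by
  have hpos : ∀ᶠ ε in 𝓝[>] (0 : ℝ), 0 < η ε := hη.eventually_gt_atTop 0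
  refine ⟨?_, fun h hh => ?_⟩
  · filter_upwards [hpos] with ε hε
    obtain ⟨H, R, hH, -⟩ := exists_stationarySolution ρ₁ ρ₂ hL hμ hε rfl
    exact ⟨H, hH, fun g hg => hg.ae_eq hL (by positivity) hH⟩
  set h₁ := firstCorrector L μ ρ₁ ρ₂ with hh₁
  set B := |3 / (8 * μ) * ((ρ₂ - ρ₁) / L)| with hB
  have hB0 : 0 ≤ B := abs_nonneg _
  set D := √(π * B ^ 2 / (μ * (2 - π / 2))) with hD
  -- By uniqueness, the given solution has the remainder of the constructed one up to a null set, so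
  -- all bounds transfer.
  have hrem : ∀ᶠ ε in 𝓝[>] (0 : ℝ), 0 < η ε ∧ ∃ R : ℝ × Circle → ℝ,
      hilbertRemainder L (η ε) ρ₁ ρ₂ h₁ (h ε) =ᵐ[slabMeasure L] R ∧
      (∀ᵐ z ∂slabMeasure L, |R z| ≤ B) ∧
      eLpNorm (fun z => R z - velocityAverage R z.1) 2 (slabMeasure L)
        ≤ ENNReal.ofReal (D * η ε ^ (-(1 / 2) : ℝ)) := by
    filter_upwards [hpos, hh] with ε hε hsol
    obtain ⟨H, R, hH, hHR, hRB, hRD⟩ := exists_stationarySolution ρ₁ ρ₂ hL hμ hε hB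
    refine ⟨hε, R, ?_, hRB, hRD⟩
    filter_upwards [hsol.ae_eq hL (by positivity) hH] with z hz
    rw [← hHR, hh₁]
    simp only [hilbertRemainder, hz]
  -- The norm of the constant `1` in `L²` of the slab, which converts sup bounds into `L²` bounds.
  set V := slabMeasure L univ ^ (2 : ℝ≥0∞).toReal⁻¹ with hV
  have hVtop : V ≠ ∞ := ENNReal.rpow_ne_top_of_nonneg (by positivity) (measure_ne_top _ _)
  refine ⟨?_, h₁, isFirstCorrector_firstCorrector hμ ρ₁ ρ₂,
    max (V * ENNReal.ofReal B).toReal D, ?_⟩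
  · have hlim : Tendsto (fun ε => V * ENNReal.ofReal ((B + B) / η ε)) (𝓝[>] 0) (𝓝 0) := by
      have h1 := ENNReal.tendsto_ofReal (hη.const_div_atTop (B + B))
      rw [ENNReal.ofReal_zero] at h1
      simpa using ENNReal.Tendsto.const_mul h1 (Or.inr hVtop)
    refine tendsto_of_tendsto_of_tendsto_of_le_of_le' tendsto_const_nhds hlim
      (Eventually.of_forall fun _ => zero_le) ?_
    filter_upwards [hrem] with ε ⟨hε, R, hR, hRB, _⟩
    refine eLpNorm_le_of_ae_bound ?_
    filter_upwards [hR, hRB] with z h1 h2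
    -- Both `R` and `h₁` are bounded by `B`, so the distance to the profile is at most `2B/η`.
    have h3 : h ε z - linearProfile L ρ₁ ρ₂ z.1 = (R z + h₁ z.2) / η ε := by
      rw [← h1, hilbertRemainder]
      field_simp
      ring
    rw [h3, norm_div, Real.norm_eq_abs, Real.norm_eq_abs, abs_of_pos hε]
    gcongr
    exact (abs_add_le _ _).trans (add_le_add h2 (abs_firstCorrector_le L μ ρ₁ ρ₂ z.2))
  · filter_upwards [hrem] with ε ⟨hε, R, hR, hRB, hRD⟩
    constructor
    · rw [eLpNorm_congr_ae hR]
      refine (eLpNorm_le_of_ae_bound (C := B) hRB).trans ?_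
      exact (ENNReal.ofReal_toReal (ENNReal.mul_ne_top hVtop ENNReal.ofReal_ne_top)).ge.trans
        (ENNReal.ofReal_le_ofReal (le_max_left _ _))
    · have hcongr : (fun z => hilbertRemainder L (η ε) ρ₁ ρ₂ h₁ (h ε) z -
          velocityAverage (hilbertRemainder L (η ε) ρ₁ ρ₂ h₁ (h ε)) z.1)
          =ᵐ[slabMeasure L] fun z => R z - velocityAverage R z.1 := by
        filter_upwards [hR, velocityAverage_congr_ae hR] with z h1 h2
        rw [h1, h2]
      rw [eLpNorm_congr_ae hcongr]
      refine hRD.trans (ENNReal.ofReal_le_ofReal ?_)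
      gcongr
      exact le_max_right _ _
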